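/- Let $m\ge 1$ and let $M$ be a connected, complete $m$-dimensional smooth Riemannian manifold that is isometrically immersed in $\mathbb{R}^n$ by a $C^\infty$ map $\varphi : M\to\mathbb{R}^n$ (that is, $M$ is a complete immersed submanifold with the induced metric). Let $\alpha$ be its second fundamental form, with norm $|\alpha(x)| = \big(\sum_{i,j}|\alpha(e_i,e_j)|^2\big)^{1/2}$ for an orthonormal basis $(e_i)$ of $T_xM$. Fix a point $p\in M$, let $\rho(x)=\mathrm{dist}_M(p,x)$ be the Riemannian distance to $p$, and let $K_0\subset K_1\subset\cdots$ be an exhaustion of $M$ by compact sets (that is, $K_i\subset \mathrm{int}\,K_{i+1}$ and $\bigcup_i K_i=M$). Put $$a_i=\sup\{\rho(x)\,|\alpha(x)| : x\in M\setminus K_i\}\in[0,\infty],\qquad a(M)=\lim_{i\to\infty}a_i\in[0,\infty],$$ where the supremum over the empty set is $0$. If $a(M)<1$, then $\varphi$ is a proper map, and $M$ is $C^\infty$-diffeomorphic to the interior of a compact smooth $m$-dimensional manifold with (possibly empty) boundary; in this sense $M$ has finite topology. -/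

import Mathlib

open Set Filter Topology
open scoped Manifold ContDiff ENNReal Bundle

noncomputable section

namespace ImmersedSubmanifold

universe u

/-- The differential of `φ : M → ℝⁿ` at `x`, as a linear map `T_x M → ℝⁿ`. -/
def differential {m n : ℕ} {M : Type u} [TopologicalSpace M]
    [ChartedSpace (EuclideanSpace ℝ (Fin m)) M] (φ : M → EuclideanSpace ℝ (Fin n)) (x : M) :
    TangentSpace (𝓡 m) x →L[ℝ] EuclideanSpace ℝ (Fin n) :=
  mfderiv (𝓡 m) (𝓡 n) φ x

/-- A map `φ : M → ℝⁿ` from an `m`-dimensional Riemannian manifold is a smooth isometric immersion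
if it is `C^∞` and its differential preserves inner products at every point. In particular the
differential is injective, and the Riemannian metric of `M` is the one induced by `φ`. -/
structure IsIsometricImmersion {m n : ℕ} {M : Type u} [TopologicalSpace M]
    [ChartedSpace (EuclideanSpace ℝ (Fin m)) M]
    [Bundle.RiemannianBundle (fun x : M => TangentSpace (𝓡 m) x)]
    (φ : M → EuclideanSpace ℝ (Fin n)) : Prop where
  contMDiff : ContMDiff (𝓡 m) (𝓡 n) ∞ φ
  inner_differential : ∀ (x : M) (v w : TangentSpace (𝓡 m) x),
    inner ℝ (differential φ x v) (differential φ x w) = inner ℝ v w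

section SecondFundamentalForm

variable {m n : ℕ} {M : Type u} [TopologicalSpace M] [ChartedSpace (EuclideanSpace ℝ (Fin m)) M]

/-- The tangent plane `dφ(T_x M) ⊆ ℝⁿ` of the immersion `φ` at `x`. -/
def tangentPlane (φ : M → EuclideanSpace ℝ (Fin n)) (x : M) :
    Submodule ℝ (EuclideanSpace ℝ (Fin n)) :=
  (differential (m := m) φ x).range

/-- The second fundamental form `α(v, w) = (D_v dφ(w))^⊥` of the immersion `φ` at `x`: the component
orthogonal to `dφ(T_x M)` of the second derivative of `φ`, read in the preferred chart at `x`
(whose coordinates are the ones that identify `T_x M` with `ℝᵐ`). Changing the chart changes the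
second derivative only by vectors of `dφ(T_x M)`, so that the normal component does not depend
on the chart. -/
def secondFundamentalForm (φ : M → EuclideanSpace ℝ (Fin n)) (x : M)
    (v w : TangentSpace (𝓡 m) x) : EuclideanSpace ℝ (Fin n) :=
  (tangentPlane (m := m) φ x)ᗮ.starProjection
    (fderiv ℝ (fderiv ℝ (φ ∘ (extChartAt (𝓡 m) x).symm)) (extChartAt (𝓡 m) x x)
      (v : EuclideanSpace ℝ (Fin m)) (w : EuclideanSpace ℝ (Fin m)))

instance instFiniteDimensionalTangentSpace (x : M) :
    FiniteDimensional ℝ (TangentSpace (𝓡 m) x) :=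
  inferInstanceAs (FiniteDimensional ℝ (EuclideanSpace ℝ (Fin m)))

variable [Bundle.RiemannianBundle (fun x : M => TangentSpace (𝓡 m) x)]

/-- The norm `|α(x)| = (∑ i, j, |α(eᵢ, eⱼ)|²)^{1/2}` of the second fundamental form, for an
orthonormal basis `(eᵢ)` of `T_x M`; the value is the same for every such basis. -/
def normSecondFundamentalForm (φ : M → EuclideanSpace ℝ (Fin n)) (x : M) : ℝ :=
  √(∑ i, ∑ j, ‖secondFundamentalForm (m := m) φ x
      (stdOrthonormalBasis ℝ (TangentSpace (𝓡 m) x) i)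
      (stdOrthonormalBasis ℝ (TangentSpace (𝓡 m) x) j)‖ ^ 2)

end SecondFundamentalForm

section DecayRate

variable {m n : ℕ} {M : Type u} [MetricSpace M] [ChartedSpace (EuclideanSpace ℝ (Fin m)) M]
  [Bundle.RiemannianBundle (fun x : M => TangentSpace (𝓡 m) x)]

/-- `sup { ρ(x) |α(x)| : x ∈ M ∖ K i } ∈ [0, ∞]`, where `ρ(x) = dist p x`. -/
def decaySup (φ : M → EuclideanSpace ℝ (Fin n)) (p : M) (K : CompactExhaustion M) (i : ℕ) : ℝ≥0∞ :=
  ⨆ x ∈ (K i)ᶜ, ENNReal.ofReal (dist p x * normSecondFundamentalForm (m := m) φ x)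

/-- `a(M) ∈ [0, ∞]`: the limit of the nonincreasing sequence `decaySup φ p K i`, that is,
its infimum. -/
def decayRate (φ : M → EuclideanSpace ℝ (Fin n)) (p : M) (K : CompactExhaustion M) : ℝ≥0∞ :=
  ⨅ i, decaySup (m := m) φ p K i

theorem tendsto_decaySup (φ : M → EuclideanSpace ℝ (Fin n)) (p : M) (K : CompactExhaustion M) :
    Tendsto (decaySup (m := m) φ p K) atTop (𝓝 (decayRate (m := m) φ p K)) :=
  tendsto_atTop_iInf fun _ _ hij =>
    biSup_mono fun _ hx hxi => hx (K.subset hij hxi)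

end DecayRate

/-- `M` is `C^∞`-diffeomorphic to the interior of a compact smooth `m`-dimensional manifold with
(possibly empty) boundary. -/
def IsInteriorOfCompact (m : ℕ) [NeZero m] (M : Type u) [TopologicalSpace M]
    [ChartedSpace (EuclideanSpace ℝ (Fin m)) M] : Prop :=
  ∃ (N : Type u) (_ : TopologicalSpace N) (_ : ChartedSpace (EuclideanHalfSpace m) N)
    (_ : IsManifold (𝓡∂ m) ∞ N) (_ : CompactSpace N) (_ : T2Space N),
    Nonempty (M ≃ₘ^∞⟮𝓡 m, 𝓡∂ m⟯
      (⟨(𝓡∂ m).interior N, (𝓡∂ m).isOpen_interior (n := ∞) (by simp)⟩ :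
        TopologicalSpace.Opens N))

end ImmersedSubmanifold

end

/-!
Let `f = ‖φ - φ p‖² / 2`, let `X` be its gradient on `M`, and let `T = dφ(X)`, which is the
tangential part of the position vector `φ - φ p`. Write `ρ` for the distance to `p`. Since `φ` does
not increase distances, `‖φ - φ p‖ ≤ ρ`, so the hypothesis gives a constant `a < 1` with
`‖φ - φ p‖ |α| ≤ a` off a compact set `K ∋ p`.

**The gradient off `K`.** Differentiating `⟪T, dφ w⟫ = ⟪φ - φ p, dφ w⟫` yields
`⟪D_v T, dφ w⟫ = ⟪v, w⟫ + ⟪φ - φ p, α(v, w)⟫` (`inner_mfderiv_tangentialPart`). Off `K` this has two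
consequences. The zeros of `T` are isolated (`eventually_tangentialPart_ne_zero`), and along the
flow of a bounded negative multiple of `X` the norm `‖T‖` decreases at least `1 - a` times as fast as
the trajectory moves (`decreasesOff_norm_tangentialPart`).

**Zeros of the gradient are confined.** A descending trajectory that never meets a neighbourhood of
`K` therefore has finite length, so by completeness it converges to a zero of `T`; and a trajectory
that starts close to an isolated zero outside `K` stays close and converges to that zero. Hence the
basins of these zeros are open. A trajectory that has met the neighbourhood of `K` cannot go far away
afterwards. So the basin of a zero of `T` far from `p` would be open and closed without containing
`p`, which is impossible as `M` is connected (`DecreasesOff.dist_le_of_stationary`). Following the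
flow from any `x` to its end, one gets `‖T‖ ≥ (1 - a) (ρ - R₂)` for a constant `R₂`. In particular
`‖T‖ ≥ 1` far from `p`; there `f` decreases along the flow at least as fast as the trajectory moves,
and the same argument gives `f ≥ ρ - R` (`exists_growth_bound`). By the Hopf–Rinow theorem
(`properSpace_of_complete`) the sublevel sets of `f` are compact, and `φ` is proper.

**Finite topology.** Let `b` be so large that `‖T‖ ≥ 1` where `f ≥ b - 1`. Then `{f ≤ b + 1}` is a
compact manifold with boundary, whose charts at the boundary have `b + 1 - f` as first coordinate
(`Sublevel.isManifold`); its interior is `{f < b + 1}`. The flow of `X / ‖X‖²`, cut off below the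
level `b`, raises `f` at unit speed above that level, and stretching `(-∞, b + 1)` to `ℝ` along its
trajectories gives a diffeomorphism from `{f < b + 1}` to `M`
(`Sublevel.isInteriorOfCompact_of_flow`).

The smooth dependence of flows on the initial point is proved in `contMDiff_flow`: the integral
equation on `[0, 1]` with the time as a parameter is solved by the implicit function theorem in the
Banach space of continuous paths.
-/

noncomputable section

/-! ### Local flows of smooth vector fields on vector spaces -/

namespace SmoothFlow

universe v

section Superposition

variable {Y : Type*} [TopologicalSpace Y] [CompactSpace Y]
  {E F : Type v} [NormedAddCommGroup E] [NormedSpace ℝ E] [NormedAddCommGroup F] [NormedSpace ℝ F]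

set_option synthInstance.maxHeartbeats 200000 in
/-- Pointwise evaluation `(A, γ) ↦ (t ↦ A t (γ t))`, as a bounded bilinear map. -/
def pointwiseApply : C(Y, E →L[ℝ] F) →L[ℝ] C(Y, E) →L[ℝ] C(Y, F) :=
  LinearMap.mkContinuous₂
    (LinearMap.mk₂ ℝ
      (fun (A : C(Y, E →L[ℝ] F)) (γ : C(Y, E)) =>
        (⟨fun t => A t (γ t), by fun_prop⟩ : C(Y, F)))
      (fun _ _ _ => by ext; simp) (fun _ _ _ => by ext; simp)
      (fun _ _ _ => by ext; simp) (fun _ _ _ => by ext; simp)) 1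
    (fun A γ => by
      rw [ContinuousMap.norm_le _ (by positivity), one_mul]
      intro t
      exact ((A t).le_opNorm _).trans (by gcongr <;> exact ContinuousMap.norm_coe_le_norm _ t))

@[simp] theorem pointwiseApply_apply (A : C(Y, E →L[ℝ] F)) (γ : C(Y, E)) (t : Y) :
    pointwiseApply A γ t = A t (γ t) := rfl

/-- The derivative of a superposition operator is pointwise: as `V'` is uniformly continuous along
the compact image of `γ`, the remainder is uniformly small. -/
theorem hasFDerivAt_superposition {V : E → F} {V' : E → E →L[ℝ] F} (hV' : Continuous V')
    (h : ∀ x, HasFDerivAt V (V' x) x) (hV : Continuous V) (γ : C(Y, E)) :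
    HasFDerivAt (fun γ : C(Y, E) => (⟨V, hV⟩ : C(E, F)).comp γ)
      (pointwiseApply ((⟨V', hV'⟩ : C(E, E →L[ℝ] F)).comp γ)) γ := by
  rw [hasFDerivAt_iff_isLittleO, Asymptotics.isLittleO_iff]
  intro c hc
  have hK : IsCompact (range γ) := isCompact_range γ.continuous
  obtain ⟨δ, hδ, hδ'⟩ := Metric.mem_uniformity_dist.1
    (hK.uniformContinuousAt_of_continuousAt V' (fun a _ => hV'.continuousAt)
      (Metric.dist_mem_uniformity hc))
  filter_upwards [Metric.ball_mem_nhds γ hδ] with γ' hγ'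
  rw [ContinuousMap.norm_le _ (by positivity)]
  intro t
  have ht : ‖γ' t - γ t‖ ≤ ‖γ' - γ‖ := ContinuousMap.norm_coe_le_norm (γ' - γ) t
  have hγt : γ' t ∈ Metric.ball (γ t) δ := by
    rw [Metric.mem_ball, dist_eq_norm]
    exact ht.trans_lt (by rwa [Metric.mem_ball, dist_eq_norm] at hγ')
  have := (convex_ball (γ t) δ).norm_image_sub_le_of_norm_hasFDerivWithin_le'
    (f := V) (f' := V') (φ := V' (γ t)) (C := c) (fun x _ => (h x).hasFDerivWithinAt)
    (fun x hx => by
      rw [← dist_eq_norm, dist_comm]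
      exact (hδ' (a := γ t) (b := x) (by rwa [dist_comm]) (mem_range_self t)).le)
    (Metric.mem_ball_self hδ) hγt
  simpa using this.trans (by gcongr)

set_option synthInstance.maxHeartbeats 200000 in
/-- A superposition operator `γ ↦ V ∘ γ` on continuous functions is as smooth as `V`: its derivative
is the superposition operator of `V'` followed by a bounded linear map. -/
theorem contDiff_superposition_nat (n : ℕ) : ∀ {F : Type v} [NormedAddCommGroup F]
    [NormedSpace ℝ F] {V : E → F} (_ : ContDiff ℝ n V) (hc : Continuous V),
    ContDiff ℝ n (fun γ : C(Y, E) => (⟨V, hc⟩ : C(E, F)).comp γ) := by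
  induction n with
  | zero =>
    intro F _ _ V hV hc
    exact contDiff_zero.2 (ContinuousMap.continuous_postcomp _)
  | succ n ih =>
    intro F _ _ V hV hc
    push_cast at hV ⊢
    obtain ⟨V', hV', h⟩ := contDiff_succ_iff_hasFDerivAt.1 hV
    exact contDiff_succ_iff_hasFDerivAt.2
      ⟨_, (pointwiseApply (Y := Y) (E := E) (F := F)).contDiff.comp (ih hV' hV'.continuous),
        hasFDerivAt_superposition hV'.continuous h hc⟩

theorem contDiff_superposition {V : E → F} (h : ContDiff ℝ ∞ V) :
    ContDiff ℝ ∞ (fun γ : C(Y, E) => (⟨V, h.continuous⟩ : C(E, F)).comp γ) :=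
  contDiff_infty.2 fun n => contDiff_superposition_nat n (contDiff_infty.1 h n) _

end Superposition

section LocalFlow

variable {E : Type v} [NormedAddCommGroup E] [NormedSpace ℝ E]

variable (E) in
/-- The embedding of `E` into the continuous functions on `[0, 1]` as the constants. -/
def constPath : E →L[ℝ] C(unitInterval, E) :=
  LinearMap.mkContinuous
    { toFun := fun x => ContinuousMap.const _ x
      map_add' := fun _ _ => rfl
      map_smul' := fun _ _ => rfl } 1
    (fun x => by
      rw [one_mul, ContinuousMap.norm_le _ (norm_nonneg _)]
      exact fun _ => le_rfl)

variable (E) in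
/-- Evaluation of continuous functions on `[0, 1]` at `1`. -/
def evalOne : C(unitInterval, E) →L[ℝ] E :=
  LinearMap.mkContinuous
    { toFun := fun γ => γ 1
      map_add' := fun _ _ => rfl
      map_smul' := fun _ _ => rfl } 1
    (fun γ => by rw [one_mul]; exact ContinuousMap.norm_coe_le_norm γ 1)

@[simp] theorem constPath_apply (x : E) (t : unitInterval) : constPath E x t = x := rfl

@[simp] theorem evalOne_apply (γ : C(unitInterval, E)) : evalOne E γ = γ 1 := rfl

/-- The primitive `t ↦ ∫ τ in 0..t, γ τ` of a continuous function on `[0, 1]`, as a bounded linear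
operator. -/
def primitive : C(unitInterval, E) →L[ℝ] C(unitInterval, E) :=
  LinearMap.mkContinuous
    { toFun := fun γ => ⟨fun t => ∫ τ in (0 : ℝ)..t, IccExtend zero_le_one γ τ, by
        have h : Continuous (IccExtend (zero_le_one' ℝ) γ) := γ.continuous.Icc_extend'
        exact (intervalIntegral.continuous_primitive (fun a b => h.intervalIntegrable a b) 0).comp
          continuous_subtype_val⟩
      map_add' := fun γ δ => by
        ext t
        have h (γ : C(unitInterval, E)) : Continuous (IccExtend (zero_le_one' ℝ) γ) :=
          γ.continuous.Icc_extend'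
        change ∫ τ in (0 : ℝ)..t, (IccExtend zero_le_one γ τ + IccExtend zero_le_one δ τ) = _
        exact intervalIntegral.integral_add ((h γ).intervalIntegrable _ _)
          ((h δ).intervalIntegrable _ _)
      map_smul' := fun c γ => by
        ext t
        change ∫ τ in (0 : ℝ)..t, c • IccExtend zero_le_one γ τ = _
        exact intervalIntegral.integral_smul c _ } 1
    (fun γ => by
      rw [one_mul, ContinuousMap.norm_le _ (norm_nonneg _)]
      intro t
      refine (intervalIntegral.norm_integral_le_of_norm_le_const (C := ‖γ‖) ?_).trans ?_
      · intro x _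
        exact ContinuousMap.norm_coe_le_norm γ _
      · rw [sub_zero, abs_of_nonneg t.2.1]
        exact mul_le_of_le_one_right (norm_nonneg _) t.2.2)

theorem primitive_apply (γ : C(unitInterval, E)) (t : unitInterval) :
    primitive γ t = ∫ τ in (0 : ℝ)..t, IccExtend zero_le_one γ τ := rfl

/-- The defect `γ - x - s ∫ V(γ)` of the integral equation of the initial value problem
`γ' = s V(γ)`, `γ 0 = x` on `[0, 1]`. -/
def integralDefect {V : E → E} (hV : Continuous V) (u : (E × ℝ) × C(unitInterval, E)) :
    C(unitInterval, E) :=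
  u.2 - constPath E u.1.1 -
    u.1.2 • primitive ((⟨V, hV⟩ : C(E, E)).comp u.2)

theorem contDiff_integralDefect {V : E → E} (hV : ContDiff ℝ ∞ V) :
    ContDiff ℝ ∞ (integralDefect hV.continuous) := by
  have h1 : ContDiff ℝ ∞ (fun u : (E × ℝ) × C(unitInterval, E) =>
      primitive ((⟨V, hV.continuous⟩ : C(E, E)).comp u.2)) :=
    primitive.contDiff.comp ((contDiff_superposition hV).comp contDiff_snd)
  have h2 : ContDiff ℝ ∞ (fun u : (E × ℝ) × C(unitInterval, E) =>
      constPath E u.1.1) :=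
    (constPath E).contDiff.comp (contDiff_fst.comp contDiff_fst)
  exact (contDiff_snd.sub h2).sub ((contDiff_snd.comp contDiff_fst).smul h1)

theorem fderiv_integralDefect_inr {V : E → E} (hV : ContDiff ℝ ∞ V) (x : E) :
    fderiv ℝ (integralDefect hV.continuous)
        ((x, 0), constPath E x) ∘L
      .inr ℝ (E × ℝ) C(unitInterval, E) = .id ℝ _ := by
  set c := constPath E x
  have h1 := ((contDiff_integralDefect hV).differentiable (by simp) ((x, 0), c)).hasFDerivAt.comp c
    (hasFDerivAt_prodMk_right ((x, 0) : E × ℝ) c)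
  refine h1.unique (((hasFDerivAt_id c).sub_const c).congr_of_eventuallyEq ?_)
  exact Eventually.of_forall fun γ => by simp [integralDefect, c]

/-- A globally defined smooth vector field on a Banach space has a local flow which depends
smoothly on time and initial point. The implicit function theorem solves the integral equation
on the fixed interval `[0, 1]`, the time being a parameter of the equation. -/
theorem exists_local_flow_of_contDiff [CompleteSpace E] {V : E → E} (hV : ContDiff ℝ ∞ V)
    (x₀ : E) :
    ∃ α : E × ℝ → E, ∃ r > 0, ∃ ε > 0,
      (∀ x ∈ Metric.closedBall x₀ r, α (x, 0) = x ∧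
        ∀ t ∈ Ioo (-ε) ε, HasDerivAt (fun t => α (x, t)) (V (α (x, t))) t) ∧
      ContDiffAt ℝ ∞ α (x₀, 0) := by
  obtain ⟨ε, hε, a, r, L, K, hr, hpl⟩ :=
    IsPicardLindelof.of_contDiffAt_one (hV.contDiffAt.of_le (m := 1) (by simp) (x := x₀))
  obtain ⟨α, hα, hαc⟩ := (hpl 0).exists_forall_mem_closedBall_eq_hasDerivWithinAt_continuousOn
  simp only [zero_sub, zero_add] at hα hαc
  have hder : ∀ x ∈ Metric.closedBall x₀ r, ∀ t ∈ Ioo (-ε) ε,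
      HasDerivAt (fun t => α (x, t)) (V (α (x, t))) t := fun x hx t ht =>
    ((hα x hx).2 t (Ioo_subset_Icc_self ht)).hasDerivAt (Icc_mem_nhds ht.1 ht.2)
  have hr' : (0 : ℝ) < r := hr
  refine ⟨α, r, hr', ε, hε, fun x hx => ⟨(hα x hx).1, hder x hx⟩, ?_⟩
  -- Continuity of `α` at `(x₀, 0)` controls the whole path `τ ↦ α (x, s τ)` for small `s`.
  have hcont : ContinuousAt α (x₀, 0) := hαc.continuousAt
    (prod_mem_nhds (Metric.closedBall_mem_nhds _ hr') (Icc_mem_nhds (by linarith) hε))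
  have hx0 : α (x₀, 0) = x₀ := (hα x₀ (Metric.mem_closedBall_self hr'.le)).1
  set c := constPath E x₀ with hc
  set u : (E × ℝ) × C(unitInterval, E) := ((x₀, 0), c) with hu
  have cdf : ContDiffAt ℝ ∞ (integralDefect hV.continuous) u :=
    (contDiff_integralDefect hV).contDiffAt
  have hinv : (fderiv ℝ (integralDefect hV.continuous) u ∘L
      .inr ℝ (E × ℝ) C(unitInterval, E)).IsInvertible := by
    rw [hu, hc, fderiv_integralDefect_inr hV x₀]
    exact ⟨ContinuousLinearEquiv.refl ℝ _, rfl⟩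
  have hFu : integralDefect hV.continuous u = 0 := by simp [integralDefect, hu, hc]
  have hev := cdf.eventually_apply_eq_iff_implicitFunction (by simp) hinv
  have hsm := cdf.contDiffAt_implicitFunction (by simp) hinv
  obtain ⟨η, hη, hη'⟩ := Metric.eventually_nhds_iff.1 hev
  obtain ⟨δ, hδ, hδ'⟩ := Metric.continuousAt_iff.1 hcont (η / 2) (by positivity)
  have hev2 : ContDiffAt ℝ ∞
      (fun z => evalOne E (cdf.implicitFunction (by simp) hinv z)) u.1 :=
    (evalOne E).contDiff.contDiffAt.comp _ hsm
  refine hev2.congr_of_eventuallyEq ?_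
  have hnear : ∀ᶠ z in 𝓝 u.1, dist z u.1 < min (min δ ε) (min (r : ℝ) η) :=
    Metric.ball_mem_nhds _ (by positivity)
  filter_upwards [hnear] with z hz
  obtain ⟨x, s⟩ := z
  simp only [lt_min_iff, hu, Prod.dist_eq, max_lt_iff, Real.dist_eq, sub_zero] at hz
  obtain ⟨⟨⟨hxδ, hsδ⟩, -, hsε⟩, ⟨hxr, -⟩, hxη, hsη⟩ := hz
  have hxr' : x ∈ Metric.closedBall x₀ r := hxr.le
  have hst : ∀ τ : ℝ, τ ∈ Icc (0 : ℝ) 1 → |s * τ| ≤ |s| := fun τ hτ => by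
    rw [abs_mul, abs_of_nonneg hτ.1]
    exact mul_le_of_le_one_right (abs_nonneg _) hτ.2
  have hmem : ∀ τ : ℝ, τ ∈ Icc (0 : ℝ) 1 → s * τ ∈ Ioo (-ε) ε := fun τ hτ =>
    abs_lt.1 ((hst τ hτ).trans_lt hsε)
  have hpath : ∀ τ ∈ Icc (0 : ℝ) 1,
      HasDerivAt (fun τ => α (x, s * τ)) (s • V (α (x, s * τ))) τ := by
    intro τ hτ
    have := (hder x hxr' _ (hmem τ hτ)).scomp τ ((hasDerivAt_id τ).const_mul s)
    simpa [Function.comp_def] using this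
  have hpc : ContinuousOn (fun τ => α (x, s * τ)) (Icc (0 : ℝ) 1) := fun τ hτ =>
    (hpath τ hτ).continuousAt.continuousWithinAt
  let γ : C(unitInterval, E) := ⟨fun τ => α (x, s * τ), hpc.domRestrict⟩
  have hγ : ∀ τ : unitInterval, γ τ = α (x, s * τ) := fun _ => rfl
  have hdist : dist ((x, s), γ) u < η := by
    simp only [hu, Prod.dist_eq, max_lt_iff, Real.dist_eq, sub_zero]
    refine ⟨⟨hxη, hsη⟩, lt_of_le_of_lt ?_ (half_lt_self hη)⟩
    rw [ContinuousMap.dist_le (by positivity)]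
    intro τ
    have h := hδ' (x := (x, s * τ)) (by
      simp only [Prod.dist_eq, max_lt_iff, Real.dist_eq, sub_zero]
      exact ⟨hxδ, (hst τ τ.2).trans_lt hsδ⟩)
    rw [hx0] at h
    exact h.le
  -- the rescaled trajectory solves the integral equation, so it is the implicit function
  have hF0 : integralDefect hV.continuous ((x, s), γ) = 0 := by
    ext τ
    have hVc : ContinuousOn (fun σ => V (α (x, s * σ))) (Icc (0 : ℝ) 1) :=
      hV.continuous.comp_continuousOn hpc
    have hsub : uIcc (0 : ℝ) τ ⊆ Icc 0 1 := by
      rw [uIcc_of_le τ.2.1]; exact Icc_subset_Icc le_rfl τ.2.2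
    have hftc : ∫ σ in (0 : ℝ)..τ, s • V (α (x, s * σ)) = α (x, s * τ) - α (x, s * 0) :=
      intervalIntegral.integral_eq_sub_of_hasDerivAt (fun σ hσ => hpath σ (hsub hσ))
        ((hVc.const_smul s).mono hsub).intervalIntegrable
    have hprim : primitive ((⟨V, hV.continuous⟩ : C(E, E)).comp γ) τ =
        ∫ σ in (0 : ℝ)..τ, V (α (x, s * σ)) := by
      rw [primitive_apply]
      refine intervalIntegral.integral_congr fun σ hσ => ?_
      simp [hγ, IccExtend_of_mem _ _ (hsub hσ)]
    rw [intervalIntegral.integral_smul, mul_zero, (hα x hxr').1] at hftc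
    simp only [integralDefect, ContinuousMap.sub_apply, ContinuousMap.smul_apply, hprim, hftc]
    simp [hγ]
  have := (hη' hdist).1 (hF0.trans hFu.symm)
  change α (x, s) = _
  rw [this]
  simp [hγ]

/-- A vector field which is smooth near `x₀` has a local flow near `x₀`, smooth at `(x₀, 0)`: cut it
off outside a ball. -/
theorem exists_local_flow [FiniteDimensional ℝ E] {V : E → E} {x₀ : E}
    (hV : ∀ᶠ x in 𝓝 x₀, ContDiffAt ℝ ∞ V x) :
    ∃ α : E × ℝ → E, ∃ r > 0, ∃ ε > 0,
      (∀ x ∈ Metric.closedBall x₀ r, α (x, 0) = x ∧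
        ∀ t ∈ Ioo (-ε) ε, HasDerivAt (fun t => α (x, t)) (V (α (x, t))) t) ∧
      ContDiffAt ℝ ∞ α (x₀, 0) := by
  obtain ⟨ρ, hρ, hρV⟩ := Metric.eventually_nhds_iff_ball.1 hV
  let b : ContDiffBump x₀ := ⟨ρ / 3, ρ / 2, by positivity, by linarith⟩
  have hW : ContDiff ℝ ∞ (fun x => b x • V x) := by
    rw [contDiff_iff_contDiffAt]
    intro x
    by_cases hx : x ∈ Metric.ball x₀ ρ
    · exact b.contDiff.contDiffAt.smul (hρV x hx)
    · refine contDiffAt_const (c := (0 : E)) |>.congr_of_eventuallyEq ?_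
      have hx' : x ∈ (Metric.closedBall x₀ (ρ / 2))ᶜ := fun h =>
        hx (Metric.closedBall_subset_ball (by linarith) h)
      filter_upwards [Metric.isClosed_closedBall.isOpen_compl.mem_nhds hx'] with y hy
      rw [b.zero_of_le_dist (le_of_lt (by simpa using hy)), zero_smul]
  obtain ⟨α, r, hr, ε, hε, hα, hsm⟩ := exists_local_flow_of_contDiff hW x₀
  have hx0 : α (x₀, 0) = x₀ := (hα x₀ (Metric.mem_closedBall_self hr.le)).1
  have hnear : ∀ᶠ z in 𝓝 (x₀, (0 : ℝ)), α z ∈ Metric.ball x₀ (ρ / 3) :=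
    hsm.continuousAt.eventually_mem (by rw [hx0]; exact Metric.ball_mem_nhds _ (by positivity))
  obtain ⟨η, hη, hη'⟩ := Metric.eventually_nhds_iff.1 hnear
  refine ⟨α, min r (η / 2), by positivity, min ε η, by positivity, fun x hx => ?_, hsm⟩
  have hxr := Metric.closedBall_subset_closedBall (min_le_left _ _) hx
  have hxη : dist x x₀ < η :=
    (Metric.closedBall_subset_closedBall (min_le_right _ _) hx).trans_lt (half_lt_self hη)
  refine ⟨(hα x hxr).1, fun t ht => ?_⟩
  have ht' : |t| < min ε η := abs_lt.2 ht
  have h1 := (hα x hxr).2 t (abs_lt.1 (ht'.trans_le (min_le_left _ _)))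
  have h2 : α (x, t) ∈ Metric.ball x₀ (ρ / 3) := hη' (by
    simp only [Prod.dist_eq, max_lt_iff, Real.dist_eq, sub_zero]
    exact ⟨hxη, ht'.trans_le (min_le_right _ _)⟩)
  rwa [b.one_of_mem_closedBall (Metric.ball_subset_closedBall h2), one_smul] at h1

end LocalFlow

end SmoothFlow

/-! ### Flows of vector fields on manifolds -/

namespace SmoothFlow

section LocalFlowManifold

variable {E : Type*} [NormedAddCommGroup E] [NormedSpace ℝ E] [FiniteDimensional ℝ E]
  {H : Type*} [TopologicalSpace H] {I : ModelWithCorners ℝ E H}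
  {M : Type*} [TopologicalSpace M] [ChartedSpace H M] [IsManifold I ∞ M]
  [I.Boundaryless] {v : (x : M) → TangentSpace I x}

/-- The local flow of a smooth vector field, transported from a chart around `x₀`. -/
theorem exists_local_flow_manifold
    (hv : ContMDiff I I.tangent ∞ (fun x => (⟨x, v x⟩ : TangentBundle I M))) (x₀ : M) :
    ∃ β : M × ℝ → M, ∃ U ∈ 𝓝 x₀, ∃ ε > 0,
      (∀ x ∈ U, β (x, 0) = x ∧ IsMIntegralCurveOn (fun t => β (x, t)) v (Ioo (-ε) ε)) ∧
      ContMDiffAt (I.prod 𝓘(ℝ, ℝ)) I ∞ β (x₀, 0) := by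
  have : IsManifold I 1 M := .of_le (n := ∞) (by simp)
  set y₀ := extChartAt I x₀ x₀ with hy₀
  set S := (extChartAt I x₀).target ∩ (extChartAt I x₀).symm ⁻¹'
    ((fun x => (⟨x, v x⟩ : TangentBundle I M)) ⁻¹' (extChartAt I.tangent ⟨x₀, v x₀⟩).source) with hS
  have hSd := ((contMDiff_iff.1 hv).2 x₀ ⟨x₀, v x₀⟩).snd
  rw [← hS] at hSd
  have htarget : (extChartAt I x₀).target ∈ 𝓝 y₀ := extChartAt_target_mem_nhds x₀
  have hSn : S ∈ 𝓝 y₀ := by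
    refine inter_mem htarget ?_
    refine (continuousAt_extChartAt_symm x₀).preimage_mem_nhds ?_
    rw [extChartAt_to_inv]
    exact hv.continuous.continuousAt.preimage_mem_nhds (extChartAt_source_mem_nhds _)
  have hVsm : ∀ᶠ y in 𝓝 y₀, ContDiffAt ℝ ∞ _ y :=
    (eventually_mem_nhds_iff.2 hSn).mono fun y hy => hSd.contDiffAt hy
  obtain ⟨α, r, hr, ε, hε, hα, hsm⟩ := exists_local_flow hVsm
  have hα0 : α (y₀, 0) = y₀ := (hα y₀ (Metric.mem_closedBall_self hr.le)).1
  have hnear : ∀ᶠ z in 𝓝 (y₀, (0 : ℝ)), α z ∈ interior (extChartAt I x₀).target :=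
    hsm.continuousAt.eventually_mem (by
      rw [hα0]; exact isOpen_interior.mem_nhds (mem_interior_iff_mem_nhds.2 htarget))
  obtain ⟨η, hη, hη'⟩ := Metric.eventually_nhds_iff.1 hnear
  have hU : (extChartAt I x₀).source ∩ extChartAt I x₀ ⁻¹' Metric.ball y₀ (min r η) ∈ 𝓝 x₀ :=
    inter_mem (extChartAt_source_mem_nhds x₀) ((continuousAt_extChartAt x₀).preimage_mem_nhds
      (Metric.ball_mem_nhds _ (by positivity)))
  refine ⟨fun z => (extChartAt I x₀).symm (α (extChartAt I x₀ z.1, z.2)), _, hU, min ε η,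
    by positivity, fun x hx => ⟨?_, ?_⟩, ?_⟩
  · have hxr : extChartAt I x₀ x ∈ Metric.closedBall y₀ r :=
      Metric.ball_subset_closedBall
        (Metric.ball_subset_ball (min_le_left _ _) hx.2)
    change (extChartAt I x₀).symm (α (extChartAt I x₀ x, 0)) = x
    rw [(hα _ hxr).1, PartialEquiv.left_inv _ hx.1]
  · have hxr : extChartAt I x₀ x ∈ Metric.closedBall y₀ r :=
      Metric.ball_subset_closedBall
        (Metric.ball_subset_ball (min_le_left _ _) hx.2)
    have hxη : dist (extChartAt I x₀ x) y₀ < η := lt_of_lt_of_le hx.2 (min_le_right _ _)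
    intro t ht
    have ht' : |t| < min ε η := abs_lt.2 ht
    set f : ℝ → E := fun t => α (extChartAt I x₀ x, t) with hf
    let xₜ : M := (extChartAt I x₀).symm (f t)
    have h : HasDerivAt f (x := t) <| fderivWithin ℝ (extChartAt I x₀ ∘ (extChartAt I xₜ).symm)
        (range I) (extChartAt I xₜ xₜ) (v xₜ) :=
      (hα _ hxr).2 t (abs_lt.1 (ht'.trans_le (min_le_left _ _)))
    rw [← tangentCoordChange_def] at h
    have hf3 : f t ∈ interior (extChartAt I x₀).target := hη' (by
      simp only [Prod.dist_eq, max_lt_iff, Real.dist_eq, sub_zero]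
      exact ⟨hxη, ht'.trans_le (min_le_right _ _)⟩)
    have hf3' := mem_of_mem_of_subset hf3 interior_subset
    have hft1 := mem_preimage.mp <|
      mem_of_mem_of_subset hf3' (extChartAt I x₀).target_subset_preimage_source
    have hft2 := mem_extChartAt_source (I := I) xₜ
    apply HasMFDerivAt.hasMFDerivWithinAt
    have hcont : ContinuousAt f t := HasDerivAt.continuousAt (F := E) h
    refine ⟨ContinuousAt.comp (f := f) (continuousAt_extChartAt_symm'' hf3') hcont, ?_⟩
    have hd : HasFDerivAt (extChartAt I xₜ ∘ (extChartAt I x₀).symm)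
        (tangentCoordChange I x₀ xₜ xₜ : E →L[ℝ] E) (f t) := by
      apply HasFDerivWithinAt.hasFDerivAt (s := range I) _ <|
        mem_nhds_iff.mpr ⟨interior (extChartAt I x₀).target,
          subset_trans interior_subset (extChartAt_target_subset_range ..),
          isOpen_interior, hf3⟩
      rw [← (extChartAt I x₀).right_inv hf3']
      exact hasFDerivWithinAt_tangentCoordChange ⟨hft1, hft2⟩
    have hv' (u : E) : tangentCoordChange I x₀ xₜ xₜ (tangentCoordChange I xₜ x₀ xₜ u) = u := by
      rw [tangentCoordChange_comp ⟨⟨hft2, hft1⟩, hft2⟩, tangentCoordChange_self hft2]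
    have hc : HasDerivAt ((extChartAt I xₜ ∘ (extChartAt I x₀).symm) ∘ f) (v xₜ : E) t :=
      (hd.comp_hasDerivAt t h).congr_deriv (hv' (v xₜ))
    have hcw : HasFDerivWithinAt ((extChartAt I xₜ ∘ (extChartAt I x₀).symm) ∘ f)
        ((1 : ℝ →L[ℝ] ℝ).smulRight (v xₜ : E)) (range 𝓘(ℝ, ℝ)) t := by
      have hw (w : E) : ContinuousLinearMap.toSpanSingleton ℝ w = (1 : ℝ →L[ℝ] ℝ).smulRight w := by
        ext
        simp
      rw [← hw (v xₜ)]
      exact (HasDerivAt.hasFDerivAt (F := E) hc).hasFDerivWithinAt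
    exact hcw
  · have h1 : ContMDiffAt (I.prod 𝓘(ℝ, ℝ)) 𝓘(ℝ, E) ∞
        (fun z : M × ℝ => extChartAt I x₀ z.1) (x₀, 0) :=
      ContMDiffAt.comp (x₀, (0 : ℝ)) (contMDiffAt_extChartAt (x := x₀)) contMDiffAt_fst
    have h2 : ContMDiffAt (I.prod 𝓘(ℝ, ℝ)) (𝓘(ℝ, E × ℝ)) ∞
        (fun z : M × ℝ => (extChartAt I x₀ z.1, z.2)) (x₀, 0) :=
      h1.prodMk_space contMDiffAt_snd
    have h3 : ContMDiffAt (I.prod 𝓘(ℝ, ℝ)) 𝓘(ℝ, E) ∞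
        (fun z : M × ℝ => α (extChartAt I x₀ z.1, z.2)) (x₀, 0) :=
      ContMDiffAt.comp (x₀, (0 : ℝ)) (g := α) hsm.contMDiffAt h2
    have h4 : ContMDiffAt 𝓘(ℝ, E) I ∞ (extChartAt I x₀).symm (α (extChartAt I x₀ x₀, 0)) := by
      rw [← hy₀, hα0]
      exact (contMDiffOn_extChartAt_symm x₀).contMDiffAt htarget
    exact ContMDiffAt.comp (x₀, (0 : ℝ)) h4 h3

/-- Integral curves of a smooth vector field are smooth, as they are locally given by a local
flow. -/
theorem contMDiffAt_of_isMIntegralCurveAt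
    (hv : ContMDiff I I.tangent ∞ (fun x => (⟨x, v x⟩ : TangentBundle I M)))
    {γ : ℝ → M} {t₀ : ℝ} (hγ : IsMIntegralCurveAt γ v t₀) :
    ContMDiffAt 𝓘(ℝ, ℝ) I ∞ γ t₀ := by
  have : IsManifold I 1 M := .of_le (n := ∞) (by simp)
  obtain ⟨β, U, hU, ε, hε, hβ, hsm⟩ := exists_local_flow_manifold hv (γ t₀)
  obtain ⟨h0, hc⟩ := hβ _ (mem_of_mem_nhds hU)
  have hc' : IsMIntegralCurveAt ((fun t => β (γ t₀, t)) ∘ (· + -t₀)) v (0 - -t₀) :=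
    (hc.isMIntegralCurveAt (Ioo_mem_nhds (by linarith) hε)).comp_add _
  rw [zero_sub, neg_neg] at hc'
  have heq : γ =ᶠ[𝓝 t₀] (fun t => β (γ t₀, t)) ∘ (· + -t₀) :=
    isMIntegralCurveAt_eventuallyEq_of_contMDiffAt_boundaryless
      ((hv (γ t₀)).of_le (by simp)) hγ hc' (by simp [h0])
  refine ContMDiffAt.congr_of_eventuallyEq ?_ heq
  have h2 : ContMDiffAt 𝓘(ℝ, ℝ) (I.prod 𝓘(ℝ, ℝ)) ∞ (fun t => (γ t₀, t + -t₀)) t₀ :=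
    contMDiffAt_const.prodMk (contDiffAt_id.add contDiffAt_const).contMDiffAt
  have h3 : ContMDiffAt (I.prod 𝓘(ℝ, ℝ)) I ∞ β (γ t₀, t₀ + -t₀) := by simpa using hsm
  exact ContMDiffAt.comp t₀ (f := fun t => (γ t₀, t + -t₀)) h3 h2

variable [T2Space M]

/-- A vector field is complete if all its maximal integral curves are defined on `ℝ`. -/
def IsCompleteField (v : (x : M) → TangentSpace I x) : Prop :=
  ∀ x, ∃ γ : ℝ → M, γ 0 = x ∧ IsMIntegralCurve γ v

/-- The flow of a complete vector field: `flow h (x, t)` is the point reached at time `t` from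
`x`. -/
def flow (h : IsCompleteField v) (z : M × ℝ) : M := (h z.1).choose z.2

omit [FiniteDimensional ℝ E] [IsManifold I ∞ M] [I.Boundaryless] [T2Space M] in
theorem flow_zero (h : IsCompleteField v) (x : M) : flow h (x, 0) = x := (h x).choose_spec.1

omit [FiniteDimensional ℝ E] [IsManifold I ∞ M] [I.Boundaryless] [T2Space M] in
theorem isMIntegralCurve_flow (h : IsCompleteField v) (x : M) :
    IsMIntegralCurve (fun t => flow h (x, t)) v := (h x).choose_spec.2

omit [FiniteDimensional ℝ E] in
theorem flow_flow (hv : ContMDiff I I.tangent ∞ (fun x => (⟨x, v x⟩ : TangentBundle I M)))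
    (h : IsCompleteField v) (x : M) (s t : ℝ) : flow h (flow h (x, s), t) = flow h (x, t + s) := by
  have : IsManifold I 1 M := .of_le (n := ∞) (by simp)
  have h1 := isMIntegralCurve_flow h (flow h (x, s))
  have h2 := (isMIntegralCurve_flow h x).comp_add s
  have := isMIntegralCurve_Ioo_eq_of_contMDiff_boundaryless (t₀ := 0) (hv.of_le (by simp)) h1 h2
    (by simp [flow_zero])
  exact congrFun this t

theorem contMDiffAt_flow_zero
    (hv : ContMDiff I I.tangent ∞ (fun x => (⟨x, v x⟩ : TangentBundle I M)))
    (h : IsCompleteField v) (x₀ : M) :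
    ContMDiffAt (I.prod 𝓘(ℝ, ℝ)) I ∞ (flow h) (x₀, 0) := by
  have : IsManifold I 1 M := .of_le (n := ∞) (by simp)
  obtain ⟨β, U, hU, ε, hε, hβ, hsm⟩ := exists_local_flow_manifold hv x₀
  refine hsm.congr_of_eventuallyEq ?_
  filter_upwards [prod_mem_nhds hU (Ioo_mem_nhds (neg_lt_zero.2 hε) hε)] with z hz
  have := isMIntegralCurveOn_Ioo_eqOn_of_contMDiff_boundaryless (t₀ := 0)
    ⟨neg_lt_zero.2 hε, hε⟩ (hv.of_le (by simp))
    ((isMIntegralCurve_flow h z.1).isMIntegralCurveOn _) (hβ z.1 hz.1).2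
    (by simp [flow_zero, (hβ z.1 hz.1).1])
  exact this hz.2

/-- The flow of a complete smooth vector field is smooth. For a finite order of differentiability,
the local statement at time `0` propagates along each trajectory by the group law. -/
theorem contMDiff_flow (hv : ContMDiff I I.tangent ∞ (fun x => (⟨x, v x⟩ : TangentBundle I M)))
    (h : IsCompleteField v) : ContMDiff (I.prod 𝓘(ℝ, ℝ)) I ∞ (flow h) := by
  rw [contMDiff_infty]
  intro n
  rintro ⟨x₀, T⟩
  -- the times at which the flow is of class `C^n` at `x₀` form an open and closed set
  suffices H : ∀ t₁ : ℝ, ∀ᶠ t in 𝓝 t₁, ∀ᶠ t' in 𝓝 t₁,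
      (ContMDiffAt (I.prod 𝓘(ℝ, ℝ)) I n (flow h) (x₀, t) →
        ContMDiffAt (I.prod 𝓘(ℝ, ℝ)) I n (flow h) (x₀, t')) by
    set A := {t : ℝ | ContMDiffAt (I.prod 𝓘(ℝ, ℝ)) I n (flow h) (x₀, t)} with hA
    have hAc : IsClopen A := by
      refine ⟨?_, ?_⟩
      · rw [← isOpen_compl_iff, isOpen_iff_mem_nhds]
        intro t₁ ht₁
        filter_upwards [H t₁] with t ht hmem
        exact ht₁ (ht.self_of_nhds hmem)
      · rw [isOpen_iff_mem_nhds]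
        intro t₁ ht₁
        filter_upwards [(H t₁).self_of_nhds] with t ht
        exact ht ht₁
    have h0 : (0 : ℝ) ∈ A := (contMDiffAt_flow_zero hv h x₀).of_le (by exact_mod_cast le_top)
    exact (hAc.eq_univ ⟨0, h0⟩ ▸ mem_univ T : T ∈ A)
  intro t₁
  have hn : ContMDiffAt (I.prod 𝓘(ℝ, ℝ)) I n (flow h) (flow h (x₀, t₁), 0) :=
    (contMDiffAt_flow_zero hv h _).of_le (by exact_mod_cast le_top)
  have hcurve : Continuous (fun t => flow h (x₀, t)) := (isMIntegralCurve_flow h x₀).continuous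
  have hev := (contMDiffAt_iff_contMDiffAt_nhds (by simp)).1 hn
  have hlim : Tendsto (fun z : ℝ × ℝ => (flow h (x₀, z.1), z.2 - z.1)) (𝓝 (t₁, t₁))
      (𝓝 (flow h (x₀, t₁), 0)) := by
    have : Continuous (fun z : ℝ × ℝ => (flow h (x₀, z.1), z.2 - z.1)) :=
      (hcurve.comp continuous_fst).prodMk (continuous_snd.sub continuous_fst)
    simpa using this.tendsto (t₁, t₁)
  have hev' := hlim.eventually hev
  rw [nhds_prod_eq] at hev'
  filter_upwards [hev'.curry] with t ht
  filter_upwards [ht] with t' ht' hmem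
  have h1 : ContMDiffAt (I.prod 𝓘(ℝ, ℝ)) I n (fun z : M × ℝ => flow h (z.1, t)) (x₀, t') := by
    have hp : ContMDiffAt (I.prod 𝓘(ℝ, ℝ)) (I.prod 𝓘(ℝ, ℝ)) n
        (fun z : M × ℝ => (z.1, t)) (x₀, t') := contMDiffAt_fst.prodMk contMDiffAt_const
    exact ContMDiffAt.comp (x₀, t') (g := flow h) hmem hp
  have h2 : ContMDiffAt (I.prod 𝓘(ℝ, ℝ)) 𝓘(ℝ, ℝ) n (fun z : M × ℝ => z.2 - t) (x₀, t') :=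
    ContMDiffAt.comp (x₀, t') (g := fun s : ℝ => s - t)
      (contDiffAt_id.sub contDiffAt_const).contMDiffAt contMDiffAt_snd
  have h3 := ContMDiffAt.comp (x₀, t') (g := flow h) ht' (h1.prodMk h2)
  refine h3.congr_of_eventuallyEq (Eventually.of_forall fun z => ?_)
  simp [flow_flow hv h]

omit [FiniteDimensional ℝ E] in
theorem flow_eq_of_eq_zero
    (hv : ContMDiff I I.tangent ∞ (fun x => (⟨x, v x⟩ : TangentBundle I M)))
    (h : IsCompleteField v) {x : M} (hx : v x = 0) (t : ℝ) : flow h (x, t) = x := by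
  have : IsManifold I 1 M := .of_le (n := ∞) (by simp)
  exact congrFun (isMIntegralCurve_Ioo_eq_of_contMDiff_boundaryless (t₀ := 0)
    (hv.of_le (by simp)) (isMIntegralCurve_flow h x) (isMIntegralCurve_const hx)
    (by simp [flow_zero])) t

/-- Suppose that for every bound `A` there is `ε > 0` such that integral curves of duration `ε` start
from all points of the integral curves through `x` of duration at most `A`. Then there is an
integral curve through `x` defined on `ℝ`. -/
theorem exists_isMIntegralCurve_of_uniform_time
    (hv : ContMDiff I I.tangent ∞ (fun x => (⟨x, v x⟩ : TangentBundle I M))) (x : M)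
    (H : ∀ A : ℝ, ∃ ε > 0, ∀ a ≤ A, ∀ γ : ℝ → M, γ 0 = x →
      IsMIntegralCurveOn γ v (Ioo (-a) a) → ∀ t ∈ Ioo (-a) a,
      ∃ γ' : ℝ → M, γ' 0 = γ t ∧ IsMIntegralCurveOn γ' v (Ioo (-ε) ε)) :
    ∃ γ : ℝ → M, γ 0 = x ∧ IsMIntegralCurve γ v := by
  have : IsManifold I 1 M := .of_le (n := ∞) (by simp)
  have hv1 := hv.of_le (m := 1) (by simp)
  let s := { a | ∃ γ, γ 0 = x ∧ IsMIntegralCurveOn γ v (Ioo (-a) a) }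
  suffices hbdd : ¬BddAbove s by
    rw [not_bddAbove_iff] at hbdd
    rw [exists_isMIntegralCurve_iff_exists_isMIntegralCurveOn_Ioo hv1]
    intro a
    obtain ⟨y, ⟨γ, hγ1, hγ2⟩, hlt⟩ := hbdd a
    exact ⟨γ, hγ1, hγ2.mono <| Ioo_subset_Ioo (neg_le_neg hlt.le) hlt.le⟩
  intro hbdd
  set A := sSup s with hA
  have hs0 : (0 : ℝ) ∈ s := ⟨fun _ => x, rfl, by simp [IsMIntegralCurveOn]⟩
  obtain ⟨β, U, hU, δ, hδ, hβ, -⟩ := exists_local_flow_manifold hv x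
  have hsδ : δ ∈ s := ⟨fun t => β (x, t), hβ x (mem_of_mem_nhds hU)⟩
  have hApos : 0 < A := hδ.trans_le (le_csSup hbdd hsδ)
  obtain ⟨ε', hε', H'⟩ := H A
  set ε := min ε' A with hεdef
  have hε : 0 < ε := lt_min hε' hApos
  have hεle : ε ≤ A := min_le_right _ _
  obtain ⟨a, ha, hlt⟩ := Real.add_neg_lt_sSup (⟨0, hs0⟩ : Set.Nonempty s) (ε := -(ε / 2))
    (by linarith)
  rw [← hA, ← sub_eq_add_neg] at hlt
  obtain ⟨γ, h0, hγ⟩ := id ha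
  -- extend `γ` at both ends by integral curves of the uniform existence time `ε`
  have hext := H' a (le_csSup hbdd ha) γ h0 hγ
  obtain ⟨γ1_aux, h1_aux, hγ1⟩ := hext (-(A - ε / 2)) ⟨by linarith, by linarith⟩
  replace hγ1 := hγ1.mono (Ioo_subset_Ioo (neg_le_neg (min_le_left ε' A)) (min_le_left ε' A))
  rw [← hεdef, ← isMIntegralCurveOn_comp_add (dt := A - ε / 2)] at hγ1
  set γ1 := γ1_aux ∘ (· + (A - ε / 2)) with γ1_def
  have heq1 : γ1 (-(A - ε / 2)) = γ (-(A - ε / 2)) := by simp [γ1_def, h1_aux]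
  obtain ⟨γ2_aux, h2_aux, hγ2⟩ := hext (A - ε / 2) ⟨by linarith, by linarith⟩
  replace hγ2 := hγ2.mono (Ioo_subset_Ioo (neg_le_neg (min_le_left ε' A)) (min_le_left ε' A))
  rw [← hεdef, ← isMIntegralCurveOn_comp_sub (dt := A - ε / 2)] at hγ2
  set γ2 := γ2_aux ∘ (· - (A - ε / 2)) with γ2_def
  have heq2 : γ2 (A - ε / 2) = γ (A - ε / 2) := by simp [γ2_def, h2_aux]
  simp_rw [Set.mem_Ioo, ← sub_lt_iff_lt_add, ← lt_sub_iff_add_lt, ← Set.mem_Ioo] at hγ1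
  simp_rw [Set.mem_Ioo, lt_sub_iff_add_lt, sub_lt_iff_lt_add, ← Set.mem_Ioo] at hγ2
  set γ_ext : ℝ → M := piecewise (Ioo (-(A + ε / 2)) a)
    (piecewise (Ioo (-a) a) γ γ1) γ2 with γ_ext_def
  have heq_ext : γ_ext 0 = x := by
    rw [γ_ext_def, piecewise, if_pos ⟨by linarith, by linarith⟩, piecewise,
      if_pos ⟨by linarith, by linarith⟩, h0]
  suffices hext : IsMIntegralCurveOn γ_ext v (Ioo (-(A + ε / 2)) (A + ε / 2)) from
    (not_lt.mpr <| le_csSup hbdd ⟨γ_ext, heq_ext, hext⟩) <| lt_add_of_pos_right A (half_pos hε)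
  apply (isMIntegralCurveOn_piecewise (t₀ := A - ε / 2) hv1 _ hγ2
      ⟨⟨by linarith, hlt⟩, ⟨by linarith, by linarith⟩⟩
      (by rw [piecewise, if_pos ⟨by linarith, hlt⟩, ← heq2])).mono
    (Ioo_subset_Ioo_union_Ioo le_rfl (by linarith) (by linarith))
  exact (isMIntegralCurveOn_piecewise (t₀ := -(A - ε / 2)) hv1 hγ hγ1
      ⟨⟨neg_lt_neg hlt, by linarith⟩, ⟨by linarith, by linarith⟩⟩ heq1.symm).mono
    (union_comm _ _ ▸ Ioo_subset_Ioo_union_Ioo (by linarith) (by linarith) le_rfl)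

end LocalFlowManifold

end SmoothFlow

/-! ### Lengths of curves, and complete Riemannian manifolds -/

namespace RiemannianGeometry

open SmoothFlow Manifold MeasureTheory

variable {E : Type*} [NormedAddCommGroup E] [NormedSpace ℝ E]
  {H : Type*} [TopologicalSpace H] {I : ModelWithCorners ℝ E H}
  {M : Type*} [MetricSpace M] [ChartedSpace H M]
  [Bundle.RiemannianBundle (fun x : M => TangentSpace I x)]
  [IsRiemannianManifold I M]

variable (I) in
theorem exists_path_length_lt {x y : M} {r : ℝ} (h : dist x y < r) :
    ∃ γ : ℝ → M, γ 0 = x ∧ γ 1 = y ∧ ContMDiffOn 𝓘(ℝ, ℝ) I 1 γ (Icc 0 1) ∧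
      pathELength I γ 0 1 < ENNReal.ofReal r := by
  refine exists_lt_of_riemannianEDist_lt ?_
  rw [← IsRiemannianManifold.out (I := I), edist_dist]
  exact (ENNReal.ofReal_lt_ofReal_iff (dist_nonneg.trans_lt h)).2 h

variable (I) in
include I in
/-- The distance in a metric space is finite, so that any two points are joined by a path. -/
theorem preconnectedSpace : PreconnectedSpace M := by
  refine ⟨isPreconnected_of_forall_pair fun x _ y _ => ?_⟩
  obtain ⟨γ, h0, h1, hγ, -⟩ := exists_path_length_lt I (lt_add_one (dist x y))
  exact ⟨γ '' Icc 0 1, subset_univ _, ⟨0, by simp, h0⟩, ⟨1, by simp, h1⟩,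
    isPreconnected_Icc.image _ hγ.continuousOn⟩

variable (I) in
theorem dist_le_of_pathELength_le {γ : ℝ → M} {a b r : ℝ}
    (hγ : ContMDiffOn 𝓘(ℝ, ℝ) I 1 γ (Icc a b)) (hab : a ≤ b) (hr : 0 ≤ r) (h : pathELength I γ a b ≤ ENNReal.ofReal r) :
    dist (γ a) (γ b) ≤ r := by
  have h1 := riemannianEDist_le_pathELength hγ rfl rfl hab
  rw [← IsRiemannianManifold.out (I := I), edist_dist] at h1
  exact (ENNReal.ofReal_le_ofReal_iff hr).1 (h1.trans h)

/-- A curve whose speed is at most the derivative of `g` moves by at most the increment of `g`. -/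
theorem dist_le_sub_of_speed_le {γ : ℝ → M} {a b : ℝ} (hab : a ≤ b)
    (hγ : ContMDiffOn 𝓘(ℝ, ℝ) I 1 γ (Icc a b)) {γ' : (t : ℝ) → TangentSpace I (γ t)}
    (hγ' : ∀ t ∈ Ioo a b, HasMFDerivAt 𝓘(ℝ, ℝ) I γ t ((1 : ℝ →L[ℝ] ℝ).smulRight (γ' t)))
    {g g' : ℝ → ℝ} (hgc : ContinuousOn g (Icc a b)) (hg : ∀ t ∈ Ioo a b, HasDerivAt g (g' t) t)
    (hle : ∀ t ∈ Ioo a b, ‖γ' t‖ ≤ g' t) : dist (γ a) (γ b) ≤ g b - g a := by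
  have hnn : ∀ t ∈ Ioo a b, 0 ≤ g' t := fun t ht => (norm_nonneg _).trans (hle t ht)
  have hint := intervalIntegral.integrableOn_deriv_of_nonneg hgc hg hnn
  have hftc := intervalIntegral.integral_eq_sub_of_hasDerivAt_of_le hab hgc hg
    ((intervalIntegrable_iff_integrableOn_Ioc_of_le hab).2 hint)
  rw [intervalIntegral.integral_of_le hab, integral_Ioc_eq_integral_Ioo] at hftc
  have hpos : 0 ≤ g b - g a := by
    rw [← hftc]
    exact setIntegral_nonneg measurableSet_Ioo hnn
  refine dist_le_of_pathELength_le I hγ hab hpos ?_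
  rw [pathELength_eq_lintegral_mfderiv_Ioo, ← hftc, ofReal_integral_eq_lintegral_ofReal
    (hint.mono_set Ioo_subset_Ioc_self)
    ((ae_restrict_iff' measurableSet_Ioo).2 (Eventually.of_forall hnn))]
  refine setLIntegral_mono' measurableSet_Ioo fun t ht => ?_
  have h1 : mfderiv 𝓘(ℝ, ℝ) I γ t (1 : ℝ) = γ' t := by
    rw [(hγ' t ht).mfderiv]
    exact one_smul ℝ _
  change ‖mfderiv 𝓘(ℝ, ℝ) I γ t (1 : ℝ)‖ₑ ≤ _
  rw [h1, ← ofReal_norm]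
  exact ENNReal.ofReal_le_ofReal (hle t ht)

variable (I) in
include I in
/-- On a path from `p` to `x` of almost minimal length there is a point at any prescribed distance
from `p`. -/
theorem exists_dist_le_and_dist_lt {p x : M} {a b : ℝ} (ha : 0 ≤ a) (hb : 0 < b)
    (h : dist p x < a + b) : ∃ y, dist p y ≤ a ∧ dist y x < b := by
  by_cases hpx : dist p x ≤ a
  · exact ⟨x, hpx, by simpa using hb⟩
  obtain ⟨γ, h0, h1, hγ, hlen⟩ := exists_path_length_lt I h
  have hc : ContinuousOn (fun t => dist p (γ t)) (Icc 0 1) :=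
    (continuous_const.dist continuous_id).comp_continuousOn hγ.continuousOn
  obtain ⟨t, ht, hta⟩ := intermediate_value_Icc zero_le_one hc
    (show a ∈ Icc (dist p (γ 0)) (dist p (γ 1)) by
      rw [h0, h1, dist_self]; exact ⟨ha, (not_le.1 hpx).le⟩)
  have hta' : dist p (γ t) = a := hta
  refine ⟨γ t, hta'.le, ?_⟩
  by_contra! hcon
  have l1 : ENNReal.ofReal a ≤ pathELength I γ 0 t := by
    rw [← hta', ← edist_dist, IsRiemannianManifold.out (I := I)]
    exact riemannianEDist_le_pathELength (hγ.mono (Icc_subset_Icc le_rfl ht.2)) h0 rfl ht.1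
  have l2 : ENNReal.ofReal b ≤ pathELength I γ t 1 := by
    refine (ENNReal.ofReal_le_ofReal hcon).trans ?_
    rw [← edist_dist, IsRiemannianManifold.out (I := I)]
    exact riemannianEDist_le_pathELength (hγ.mono (Icc_subset_Icc ht.1 le_rfl)) rfl h1 ht.2
  rw [← pathELength_add ht.1 ht.2, ENNReal.ofReal_add ha hb.le] at hlen
  exact (add_le_add l1 l2).not_gt hlen

variable (I) in
include I in
/-- Closed bounded subsets of a complete Riemannian manifold are compact (Hopf–Rinow). The set of
radii of compact closed balls is closed by completeness and open by local compactness. -/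
theorem properSpace_of_complete [FiniteDimensional ℝ E] [CompleteSpace M] : ProperSpace M := by
  have : LocallyCompactSpace M := Manifold.locallyCompact_of_finiteDimensional I
  refine ⟨fun p R => ?_⟩
  rcases lt_or_ge R 0 with hR | hR
  · rw [Metric.closedBall_eq_empty.2 hR]; exact isCompact_empty
  set S := {r : ℝ | IsCompact (Metric.closedBall p r)} with hS
  have hmono : ∀ {r r'}, r ≤ r' → r' ∈ S → r ∈ S := fun hrr' h =>
    IsCompact.of_isClosed_subset h Metric.isClosed_closedBall
      (Metric.closedBall_subset_closedBall hrr')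
  suffices hsub : Icc 0 R ⊆ S from hsub (right_mem_Icc.2 hR)
  refine IsClosed.Icc_subset_of_forall_exists_gt ?_ ?_ ?_
  · refine isClosed_of_closure_subset fun r hr => ?_
    have hr' : r ∈ Icc 0 R := isClosed_Icc.closure_subset
      (closure_mono inter_subset_right hr)
    refine ⟨?_, hr'⟩
    refine isCompact_iff_totallyBounded_isComplete.2 ⟨?_, Metric.isClosed_closedBall.isComplete⟩
    rw [Metric.totallyBounded_iff]
    intro ε hε
    obtain ⟨s, ⟨hsS, hs0, -⟩, hrs⟩ := Metric.mem_closure_iff.1 hr (ε / 2) (by positivity)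
    rw [Real.dist_eq] at hrs
    obtain ⟨t, ht, hcov⟩ := Metric.totallyBounded_iff.1 (IsCompact.totallyBounded hsS) (ε / 2)
      (by positivity)
    refine ⟨t, ht, fun x hx => ?_⟩
    obtain ⟨y, hy, hyx⟩ := exists_dist_le_and_dist_lt I (p := p) (x := x) hs0 (half_pos hε)
      (by rw [dist_comm]; exact lt_of_le_of_lt hx (by linarith [(abs_lt.1 hrs).2]))
    obtain ⟨z, hz, hyz⟩ := mem_iUnion₂.1 (hcov (show y ∈ Metric.closedBall p s by
      rwa [Metric.mem_closedBall, dist_comm]))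
    refine mem_iUnion₂.2 ⟨z, hz, ?_⟩
    rw [Metric.mem_ball] at hyz ⊢
    linarith [dist_triangle x y z, dist_comm x y]
  · change IsCompact _
    simp
  · rintro r ⟨hrS, hr0, hrR⟩ y hy
    obtain ⟨K', hK', hsubK⟩ :=
      exists_compact_superset (show IsCompact (Metric.closedBall p r) from hrS)
    obtain ⟨δ, hδ, hthick⟩ := IsCompact.exists_thickening_subset_open hrS isOpen_interior hsubK
    have hrδ : r + δ / 2 ∈ S := by
      refine hK'.of_isClosed_subset Metric.isClosed_closedBall fun x hx => ?_
      refine interior_subset (hthick ?_)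
      rw [Metric.mem_closedBall, dist_comm] at hx
      obtain ⟨y, hy, hyx⟩ := exists_dist_le_and_dist_lt I hr0 hδ (by linarith : dist p x < r + δ)
      exact Metric.mem_thickening_iff.2 ⟨y, by rwa [Metric.mem_closedBall, dist_comm],
        by rwa [dist_comm]⟩
    exact ⟨min y (r + δ / 2), hmono (min_le_right _ _) hrδ,
      lt_min hy (by linarith), min_le_left _ _⟩

/-- A bounded smooth vector field on a complete Riemannian manifold is complete, since its integral
curves of bounded duration stay in a compact ball. -/
theorem isCompleteField_of_bounded [FiniteDimensional ℝ E] [IsManifold I ∞ M] [I.Boundaryless]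
    [CompleteSpace M] {v : (x : M) → TangentSpace I x}
    (hv : ContMDiff I I.tangent ∞ (fun x => (⟨x, v x⟩ : TangentBundle I M))) {C : ℝ}
    (hC : ∀ x, ‖v x‖ ≤ C) : IsCompleteField v := by
  have : ProperSpace M := properSpace_of_complete I
  intro x
  refine exists_isMIntegralCurve_of_uniform_time hv x fun A => ?_
  have hC0 : 0 ≤ C := (norm_nonneg _).trans (hC x)
  -- A uniform existence time on a closed ball, by compactness.
  obtain ⟨ε, hε, hball⟩ : ∃ ε > 0, ∀ y ∈ Metric.closedBall x (C * A),
      ∃ γ' : ℝ → M, γ' 0 = y ∧ IsMIntegralCurveOn γ' v (Ioo (-ε) ε) := by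
    refine (isCompact_closedBall x (C * A)).induction_on
      (p := fun s => ∃ ε > 0, ∀ y ∈ s,
        ∃ γ' : ℝ → M, γ' 0 = y ∧ IsMIntegralCurveOn γ' v (Ioo (-ε) ε)) ?_ ?_ ?_ ?_
    · exact ⟨1, one_pos, by simp⟩
    · rintro s t hst ⟨ε, hε, h⟩
      exact ⟨ε, hε, fun y hy => h y (hst hy)⟩
    · rintro s t ⟨ε₁, hε₁, h₁⟩ ⟨ε₂, hε₂, h₂⟩
      refine ⟨min ε₁ ε₂, lt_min hε₁ hε₂, ?_⟩
      rintro y (hy | hy)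
      · obtain ⟨γ', h0, hγ'⟩ := h₁ y hy
        exact ⟨γ', h0, hγ'.mono (Ioo_subset_Ioo (neg_le_neg (min_le_left _ _)) (min_le_left _ _))⟩
      · obtain ⟨γ', h0, hγ'⟩ := h₂ y hy
        exact ⟨γ', h0, hγ'.mono (Ioo_subset_Ioo (neg_le_neg (min_le_right _ _)) (min_le_right _ _))⟩
    · intro y _
      obtain ⟨β, U, hU, ε, hε, hβ, -⟩ := exists_local_flow_manifold hv y
      exact ⟨U, mem_nhdsWithin_of_mem_nhds hU, ε, hε, fun z hz => ⟨fun t => β (z, t), hβ z hz⟩⟩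
  refine ⟨ε, hε, fun a ha γ h0 hγ t ht => hball _ ?_⟩
  have hat : ∀ s ∈ Ioo (-a) a, IsMIntegralCurveAt γ v s := fun s hs =>
    hγ.isMIntegralCurveAt (Ioo_mem_nhds hs.1 hs.2)
  have key : ∀ s ∈ Ioo (-a) a, ∀ s' ∈ Ioo (-a) a, s ≤ s' → dist (γ s) (γ s') ≤ C * (s' - s) := by
    intro s hs s' hs' hss'
    have hmem : ∀ τ ∈ Icc s s', τ ∈ Ioo (-a) a := fun τ hτ =>
      ⟨hs.1.trans_le hτ.1, hτ.2.trans_lt hs'.2⟩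
    refine (dist_le_sub_of_speed_le hss' (γ := γ) (γ' := fun t => v (γ t)) (g := fun τ => C * τ)
      (g' := fun _ => C)
      (fun τ hτ => ((contMDiffAt_of_isMIntegralCurveAt hv (hat τ (hmem τ hτ))).of_le
        (by simp)).contMDiffWithinAt)
      (fun τ hτ => (hat τ (hmem τ (Ioo_subset_Icc_self hτ))).hasMFDerivAt) (by fun_prop)
      (fun τ _ => by simpa using (hasDerivAt_id τ).const_mul C) (fun τ _ => hC _)).trans_eq ?_
    ring
  have h0mem : (0 : ℝ) ∈ Ioo (-a) a := ⟨by linarith [ht.1, ht.2], by linarith [ht.1, ht.2]⟩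
  rw [Metric.mem_closedBall, dist_comm, ← h0]
  rcases le_total 0 t with h | h
  · refine (key 0 h0mem t ht h).trans ?_
    gcongr
    linarith [ht.2]
  · rw [dist_comm]
    refine (key t ht 0 h0mem h).trans ?_
    gcongr
    linarith [ht.1]

/-- A map whose differential preserves norms does not increase distances. -/
theorem dist_map_le {F : Type*} [NormedAddCommGroup F] [InnerProductSpace ℝ F] [IsManifold I 1 M]
    {φ : M → F}
    (hφ : ContMDiff I 𝓘(ℝ, F) 1 φ)
    (hnorm : ∀ (x : M) (w : TangentSpace I x), ‖(show F from mfderiv I 𝓘(ℝ, F) φ x w)‖ = ‖w‖)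
    (x y : M) : dist (φ x) (φ y) ≤ dist x y := by
  refine le_of_forall_gt fun r hr => ?_
  obtain ⟨γ, h0, h1, hγ, hlen⟩ := exists_path_length_lt I hr
  have hr0 : 0 < r := dist_nonneg.trans_lt hr
  have hcomp : ContMDiffOn 𝓘(ℝ, ℝ) 𝓘(ℝ, F) 1 (φ ∘ γ) (Icc 0 1) := hφ.comp_contMDiffOn hγ
  have hl : pathELength 𝓘(ℝ, F) (φ ∘ γ) 0 1 = pathELength I γ 0 1 := by
    rw [pathELength_eq_lintegral_mfderiv_Ioo, pathELength_eq_lintegral_mfderiv_Ioo]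
    refine setLIntegral_congr_fun measurableSet_Ioo fun t ht => ?_
    have hγt : MDifferentiableAt 𝓘(ℝ, ℝ) I γ t :=
      ((hγ t (Ioo_subset_Icc_self ht)).contMDiffAt (Icc_mem_nhds ht.1 ht.2)).mdifferentiableAt
        (by simp)
    have hm : mfderiv 𝓘(ℝ, ℝ) 𝓘(ℝ, F) (φ ∘ γ) t (1 : ℝ) =
        mfderiv I 𝓘(ℝ, F) φ (γ t) (mfderiv 𝓘(ℝ, ℝ) I γ t (1 : ℝ)) := by
      rw [mfderiv_comp t ((hφ (γ t)).mdifferentiableAt (by simp)) hγt]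
      rfl
    change ‖mfderiv 𝓘(ℝ, ℝ) 𝓘(ℝ, F) (φ ∘ γ) t (1 : ℝ)‖ₑ = ‖mfderiv 𝓘(ℝ, ℝ) I γ t (1 : ℝ)‖ₑ
    rw [hm, enorm_tangentSpace_vectorSpace]
    have h := congrArg ENNReal.ofReal (hnorm (γ t) (mfderiv 𝓘(ℝ, ℝ) I γ t (1 : ℝ)))
    rw [ofReal_norm, ofReal_norm] at h
    exact h
  have h2 := riemannianEDist_le_pathELength hcomp rfl rfl zero_le_one
  rw [hl, ← IsRiemannianManifold.out (I := 𝓘(ℝ, F)), edist_dist] at h2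
  have h3 := h2.trans_lt hlen
  rw [ENNReal.ofReal_lt_ofReal_iff hr0] at h3
  simpa [h0, h1] using h3

end RiemannianGeometry

/-! ### The tangential part of the position vector -/

namespace ImmersedSubmanifold

section Pointwise

variable {m n : ℕ} {M : Type*} [TopologicalSpace M] [ChartedSpace (EuclideanSpace ℝ (Fin m)) M]

/-- In the preferred chart at `x` the tangent space is identified with `ℝᵐ`, and the differential
is the derivative of the coordinate expression. -/
theorem mfderiv_eq_fderiv_chart {F : Type*} [NormedAddCommGroup F] [NormedSpace ℝ F] {f : M → F}
    {x : M} (hf : MDifferentiableAt (𝓡 m) 𝓘(ℝ, F) f x) :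
    (mfderiv (𝓡 m) 𝓘(ℝ, F) f x : EuclideanSpace ℝ (Fin m) →L[ℝ] F) =
      fderiv ℝ (f ∘ (extChartAt (𝓡 m) x).symm) (extChartAt (𝓡 m) x x) := by
  unfold mfderiv
  erw [if_pos hf]
  simp only [writtenInExtChartAt, extChartAt_model_space_eq_id, PartialEquiv.refl_coe,
    modelWithCornersSelf_coe, range_id, fderivWithin_univ, Function.id_comp]
  rfl

variable [Bundle.RiemannianBundle (fun x : M => TangentSpace (𝓡 m) x)]

/-- The second fundamental form, as a bilinear map. -/
def secondFundamentalFormₗ (φ : M → EuclideanSpace ℝ (Fin n)) (x : M) :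
    TangentSpace (𝓡 m) x →ₗ[ℝ] TangentSpace (𝓡 m) x →ₗ[ℝ] EuclideanSpace ℝ (Fin n) :=
  LinearMap.mk₂ ℝ (secondFundamentalForm (m := m) φ x)
    (fun v₁ v₂ w => by
      unfold secondFundamentalForm
      erw [map_add, add_apply, map_add])
    (fun c v w => by
      unfold secondFundamentalForm
      erw [map_smul, smul_apply, map_smul])
    (fun v w₁ w₂ => by
      unfold secondFundamentalForm
      erw [map_add, map_add])
    (fun c v w => by
      unfold secondFundamentalForm
      erw [map_smul, map_smul])

omit [Bundle.RiemannianBundle (fun x : M => TangentSpace (𝓡 m) x)] in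
theorem secondFundamentalFormₗ_apply (φ : M → EuclideanSpace ℝ (Fin n)) (x : M)
    (v w : TangentSpace (𝓡 m) x) :
    secondFundamentalFormₗ φ x v w = secondFundamentalForm (m := m) φ x v w := rfl

/-- The operator norm of the second fundamental form is at most its Hilbert–Schmidt norm. -/
theorem norm_secondFundamentalForm_le (φ : M → EuclideanSpace ℝ (Fin n)) (x : M)
    (v w : TangentSpace (𝓡 m) x) :
    ‖secondFundamentalForm (m := m) φ x v w‖ ≤
      normSecondFundamentalForm (m := m) φ x * (‖v‖ * ‖w‖) := by
  set b := stdOrthonormalBasis ℝ (TangentSpace (𝓡 m) x) with hb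
  have hexp : secondFundamentalForm (m := m) φ x v w =
      ∑ i, ∑ j, (inner ℝ (b i) v * inner ℝ (b j) w) •
        secondFundamentalForm (m := m) φ x (b i) (b j) := by
    rw [← secondFundamentalFormₗ_apply]
    conv_lhs => rw [← b.sum_repr' v, ← b.sum_repr' w]
    simp only [map_sum, map_smul, LinearMap.sum_apply, LinearMap.smul_apply, Finset.smul_sum,
      smul_smul, secondFundamentalFormₗ_apply]
    rw [Finset.sum_comm]
    simp only [mul_comm]
  rw [hexp]
  simp only [← Finset.sum_product', Finset.univ_product_univ]
  refine (norm_sum_le _ _).trans ?_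
  simp only [norm_smul]
  refine (Real.sum_mul_le_sqrt_mul_sqrt _ _ _).trans ?_
  rw [mul_comm]
  have h1 : √(∑ z : Fin _ × Fin _, ‖inner ℝ (b z.1) v * inner ℝ (b z.2) w‖ ^ 2) = ‖v‖ * ‖w‖ := by
    simp only [norm_mul, mul_pow]
    rw [← Finset.univ_product_univ, Finset.sum_product]
    simp only [← Finset.mul_sum, ← Finset.sum_mul]
    rw [b.sum_sq_norm_inner_right, b.sum_sq_norm_inner_right, Real.sqrt_mul (by positivity),
      Real.sqrt_sq (norm_nonneg _), Real.sqrt_sq (norm_nonneg _)]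
  have h2 : √(∑ z : Fin _ × Fin _, ‖secondFundamentalForm (m := m) φ x (b z.1) (b z.2)‖ ^ 2) =
      normSecondFundamentalForm (m := m) φ x := by
    rw [normSecondFundamentalForm, ← Finset.univ_product_univ, Finset.sum_product]
  rw [h1, h2]

end Pointwise

section Gram

variable {E F : Type*} [NormedAddCommGroup E] [NormedSpace ℝ E] [NormedAddCommGroup F]
  [InnerProductSpace ℝ F]

/-- The bilinear form `(u, w) ↦ ⟪A u, A w⟫` pulled back by a linear map `A`. -/
def gram (A : E →L[ℝ] F) : E →L[ℝ] E →L[ℝ] ℝ :=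
  ((ContinuousLinearMap.compL ℝ E F ℝ).flip A) ∘L ((innerSL ℝ : F →L[ℝ] F →L[ℝ] ℝ) ∘L A)

@[simp] theorem gram_apply (A : E →L[ℝ] F) (u w : E) : gram A u w = inner ℝ (A u) (A w) := rfl

theorem contDiff_gram : ContDiff ℝ ∞ (gram : (E →L[ℝ] F) → E →L[ℝ] E →L[ℝ] ℝ) :=
  (ContinuousLinearMap.contDiff _).clm_comp (contDiff_const.clm_comp contDiff_id)

/-- The Gram form of an injective linear map is positive definite, hence nondegenerate. -/
theorem isInvertible_gram [FiniteDimensional ℝ E] {A : E →L[ℝ] F} (hA : Function.Injective A) :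
    (gram A).IsInvertible := by
  have hinj : Function.Injective (gram A : E →ₗ[ℝ] E →L[ℝ] ℝ) := by
    rw [injective_iff_map_eq_zero]
    intro u hu
    have : inner ℝ (A u) (A u) = 0 := by
      rw [← gram_apply]
      exact congrArg (fun L : E →L[ℝ] ℝ => L u) hu
    exact (injective_iff_map_eq_zero A).1 hA u (inner_self_eq_zero.1 this)
  have hfr : Module.finrank ℝ E = Module.finrank ℝ (E →L[ℝ] ℝ) := by
    rw [← (LinearMap.toContinuousLinearMap : (E →ₗ[ℝ] ℝ) ≃ₗ[ℝ] (E →L[ℝ] ℝ)).finrank_eq]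
    exact (Subspace.dual_finrank_eq (K := ℝ) (V := E)).symm
  exact ⟨(LinearEquiv.ofInjectiveOfFinrankEq _ hinj hfr).toContinuousLinearEquiv, rfl⟩

end Gram

/-- If `T` is the orthogonal projection of `a` to `K`, the component of `W` orthogonal to `K` pairs
with `a` as `W` pairs with `a - T`. -/
theorem inner_starProjection_orthogonal {F : Type*} [NormedAddCommGroup F] [InnerProductSpace ℝ F]
    {K : Submodule ℝ F} [K.HasOrthogonalProjection] {a T : F} (hT : T ∈ K)
    (ha : ∀ u ∈ K, inner ℝ T u = inner ℝ a u) (W : F) :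
    inner ℝ a (Kᗮ.starProjection W) = inner ℝ a W - inner ℝ T W := by
  have h1 := K.starProjection_add_starProjection_orthogonal W
  have h2 : inner ℝ T (Kᗮ.starProjection W) = 0 :=
    Submodule.inner_right_of_mem_orthogonal hT (Submodule.starProjection_apply_mem _ _)
  have h3 := ha _ (K.starProjection_apply_mem W)
  have h4 : inner ℝ a W = inner ℝ a (K.starProjection W) + inner ℝ a (Kᗮ.starProjection W) := by
    rw [← inner_add_right, h1]
  have h5 : inner ℝ T W = inner ℝ T (K.starProjection W) + inner ℝ T (Kᗮ.starProjection W) := by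
    rw [← inner_add_right, h1]
  linarith

section Gradient

variable {m n : ℕ} {M : Type*} [TopologicalSpace M] [ChartedSpace (EuclideanSpace ℝ (Fin m)) M]
  [Bundle.RiemannianBundle (fun x : M => TangentSpace (𝓡 m) x)]

/-- The gradient of `x ↦ ‖φ x - c‖² / 2` with respect to the metric of `M`. -/
def gradField (φ : M → EuclideanSpace ℝ (Fin n)) (c : EuclideanSpace ℝ (Fin n)) (x : M) :
    TangentSpace (𝓡 m) x :=
  have : CompleteSpace (TangentSpace (𝓡 m) x) := FiniteDimensional.complete ℝ _
  (InnerProductSpace.toDual ℝ (TangentSpace (𝓡 m) x)).symm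
    ((innerSL ℝ (φ x - c)) ∘L differential φ x)

/-- The tangential part of the position vector `φ x - c`, i.e. the image of `gradField φ c x` in
`ℝⁿ`. -/
def tangentialPart (m : ℕ) {n : ℕ} {M : Type*} [TopologicalSpace M]
    [ChartedSpace (EuclideanSpace ℝ (Fin m)) M]
    [Bundle.RiemannianBundle (fun x : M => TangentSpace (𝓡 m) x)]
    (φ : M → EuclideanSpace ℝ (Fin n)) (c : EuclideanSpace ℝ (Fin n)) (x : M) :
    EuclideanSpace ℝ (Fin n) :=
  differential (m := m) φ x (gradField φ c x)

variable {φ : M → EuclideanSpace ℝ (Fin n)} {c : EuclideanSpace ℝ (Fin n)}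

theorem inner_gradField (x : M) (w : TangentSpace (𝓡 m) x) :
    inner ℝ (gradField φ c x) w = inner ℝ (φ x - c) (differential φ x w) := by
  have : CompleteSpace (TangentSpace (𝓡 m) x) := FiniteDimensional.complete ℝ _
  rw [gradField, InnerProductSpace.toDual_symm_apply]
  rfl

namespace IsIsometricImmersion

variable (hφ : IsIsometricImmersion (m := m) φ)
include hφ

theorem norm_differential (x : M) (w : TangentSpace (𝓡 m) x) : ‖differential φ x w‖ = ‖w‖ := by
  rw [@norm_eq_sqrt_real_inner, @norm_eq_sqrt_real_inner _ _ _ w, hφ.inner_differential]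

theorem norm_tangentialPart (x : M) : ‖tangentialPart m φ c x‖ = ‖gradField (m := m) φ c x‖ :=
  hφ.norm_differential x _

theorem inner_tangentialPart (x : M) (w : TangentSpace (𝓡 m) x) :
    inner ℝ (tangentialPart m φ c x) (differential φ x w) =
      inner ℝ (φ x - c) (differential φ x w) := by
  rw [tangentialPart, hφ.inner_differential, inner_gradField]

theorem norm_tangentialPart_le (x : M) : ‖tangentialPart m φ c x‖ ≤ ‖φ x - c‖ := by
  have h := hφ.inner_tangentialPart (c := c) x (gradField φ c x)
  have h2 : ‖tangentialPart m φ c x‖ * ‖tangentialPart m φ c x‖ ≤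
      ‖φ x - c‖ * ‖tangentialPart m φ c x‖ := by
    rw [← real_inner_self_eq_norm_mul_norm]
    exact h.trans_le (real_inner_le_norm _ _)
  rcases (norm_nonneg (tangentialPart m φ c x)).eq_or_lt with h0 | h0
  · rw [← h0]; exact norm_nonneg _
  · exact le_of_mul_le_mul_right h2 h0

variable [IsManifold (𝓡 m) ∞ M]

/-- The gradient, read in the chart at `x₀`, is smooth: it solves a linear system with smooth
coefficients, the matrix of which is the Gram matrix of the coordinate vector fields. The same
coordinate expression `Y` describes the tangential part. -/
theorem exists_chart_gradField (c : EuclideanSpace ℝ (Fin n)) (x₀ : M) :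
    ∃ Y : EuclideanSpace ℝ (Fin m) → EuclideanSpace ℝ (Fin m),
      ContDiffOn ℝ ∞ Y (extChartAt (𝓡 m) x₀).target ∧
      ∀ x ∈ (extChartAt (𝓡 m) x₀).source,
        mfderiv (𝓡 m) 𝓘(ℝ, EuclideanSpace ℝ (Fin m)) (extChartAt (𝓡 m) x₀) x (gradField φ c x) =
          Y (extChartAt (𝓡 m) x₀ x) ∧
        tangentialPart m φ c x = fderiv ℝ (φ ∘ (extChartAt (𝓡 m) x₀).symm)
          (extChartAt (𝓡 m) x₀ x) (Y (extChartAt (𝓡 m) x₀ x)) ∧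
        ∀ u, inner ℝ (tangentialPart m φ c x)
            (fderiv ℝ (φ ∘ (extChartAt (𝓡 m) x₀).symm) (extChartAt (𝓡 m) x₀ x) u) =
          inner ℝ (φ x - c)
            (fderiv ℝ (φ ∘ (extChartAt (𝓡 m) x₀).symm) (extChartAt (𝓡 m) x₀ x) u) := by
  set e := extChartAt (𝓡 m) x₀ with he
  set ψ : EuclideanSpace ℝ (Fin m) → EuclideanSpace ℝ (Fin n) := φ ∘ e.symm with hψ
  set A : EuclideanSpace ℝ (Fin m) → EuclideanSpace ℝ (Fin m) →L[ℝ] EuclideanSpace ℝ (Fin n) :=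
    fun y => fderiv ℝ ψ y with hA
  have hopen : IsOpen e.target := isOpen_extChartAt_target x₀
  have hψd : ContDiffOn ℝ ∞ ψ e.target := by
    rw [← contMDiffOn_iff_contDiffOn]
    exact hφ.contMDiff.comp_contMDiffOn (contMDiffOn_extChartAt_symm x₀)
  have hAd : ContDiffOn ℝ ∞ A e.target := hψd.fderiv_of_isOpen hopen (by simp)
  -- The chain rule expresses `dφ` through the coordinates.
  have hchain : ∀ x ∈ e.source, ∀ w : TangentSpace (𝓡 m) x, differential φ x w =
      A (e x) (mfderiv (𝓡 m) 𝓘(ℝ, EuclideanSpace ℝ (Fin m)) e x w) := by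
    intro x hx w
    have hy : e x ∈ e.target := e.map_source hx
    have hd1 : MDifferentiableAt (𝓡 m) 𝓘(ℝ, EuclideanSpace ℝ (Fin m)) e x :=
      mdifferentiableAt_extChartAt (by rwa [he, extChartAt_source] at hx)
    have hd2 : MDifferentiableAt 𝓘(ℝ, EuclideanSpace ℝ (Fin m))
        𝓘(ℝ, EuclideanSpace ℝ (Fin n)) ψ (e x) :=
      ((hψd.contDiffAt (hopen.mem_nhds hy)).differentiableAt (by simp)).mdifferentiableAt
    have heq : φ =ᶠ[𝓝 x] ψ ∘ e := by
      filter_upwards [(isOpen_extChartAt_source x₀).mem_nhds hx] with z hz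
      simp only [hψ, Function.comp_apply]
      rw [e.left_inv hz]
    have h1 : mfderiv (𝓡 m) (𝓡 n) φ x = mfderiv (𝓡 m) (𝓡 n) (ψ ∘ e) x := heq.mfderiv_eq
    have h2 := mfderiv_comp x hd2 hd1
    rw [mfderiv_eq_fderiv] at h2
    unfold differential
    rw [h1, h2]
    rfl
  have hAinj : ∀ x ∈ e.source, Function.Injective (A (e x)) := by
    intro x hx
    rw [injective_iff_map_eq_zero]
    intro u hu
    obtain ⟨w, rfl⟩ := (isInvertible_mfderiv_extChartAt hx).bijective.surjective u
    have h1 := hchain x hx w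
    rw [hu] at h1
    have h2 := hφ.norm_differential x w
    rw [h1, norm_zero] at h2
    rw [norm_eq_zero.1 h2.symm]
    exact map_zero _
  refine ⟨fun y => (gram (A y)).inverse ((innerSL ℝ (ψ y - c)) ∘L A y), ?_, fun x hx => ?_⟩
  · intro y hy
    have hx : e.symm y ∈ e.source := e.map_target hy
    have hinj := hAinj _ hx
    rw [e.right_inv hy] at hinj
    obtain ⟨B, hB⟩ := isInvertible_gram hinj
    have hAy : ContDiffAt ℝ ∞ A y := hAd.contDiffAt (hopen.mem_nhds hy)
    have hψy : ContDiffAt ℝ ∞ ψ y := hψd.contDiffAt (hopen.mem_nhds hy)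
    have h1 : ContDiffAt ℝ ∞ (fun y => (gram (A y)).inverse) y := by
      refine ContDiffAt.comp y (g := ContinuousLinearMap.inverse) ?_
        (contDiff_gram.contDiffAt.comp y hAy)
      rw [← hB]
      exact contDiffAt_map_inverse B
    have h2 : ContDiffAt ℝ ∞ (fun y => (innerSL ℝ : _ →L[ℝ] _ →L[ℝ] ℝ) (ψ y - c)) y :=
      (ContinuousLinearMap.contDiff _).contDiffAt.comp y (hψy.sub contDiffAt_const)
    exact (h1.clm_apply (h2.clm_comp hAy)).contDiffWithinAt
  · have hmain : gram (A (e x)) (mfderiv (𝓡 m) 𝓘(ℝ, EuclideanSpace ℝ (Fin m)) e x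
        (gradField φ c x)) = (innerSL ℝ (ψ (e x) - c)) ∘L A (e x) := by
      ext u
      obtain ⟨w, rfl⟩ := (isInvertible_mfderiv_extChartAt hx).bijective.surjective u
      have h3 : ψ (e x) = φ x := by simp only [hψ, Function.comp_apply]; rw [e.left_inv hx]
      have h4 := (hφ.inner_differential x (gradField φ c x) w).trans (inner_gradField x w)
      rw [hchain x hx, hchain x hx, ← h3] at h4
      exact h4
    have hinv : mfderiv (𝓡 m) 𝓘(ℝ, EuclideanSpace ℝ (Fin m)) e x (gradField φ c x) =
        (gram (A (e x))).inverse ((innerSL ℝ (ψ (e x) - c)) ∘L A (e x)) := by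
      obtain ⟨B, hB⟩ := isInvertible_gram (hAinj x hx)
      rw [← hmain, ← hB, ContinuousLinearMap.inverse_equiv]
      exact (B.symm_apply_apply _).symm
    refine ⟨hinv, ?_, fun u => ?_⟩
    · rw [tangentialPart, hchain x hx, hinv]
    · obtain ⟨w, rfl⟩ := (isInvertible_mfderiv_extChartAt hx).bijective.surjective u
      have h4 := hφ.inner_tangentialPart (c := c) x w
      rw [hchain x hx] at h4
      exact h4

theorem contMDiff_gradField (c : EuclideanSpace ℝ (Fin n)) :
    ContMDiff (𝓡 m) (𝓡 m).tangent ∞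
      (fun x => (⟨x, gradField φ c x⟩ : TangentBundle (𝓡 m) M)) := by
  intro x₀
  refine (Bundle.contMDiffAt_section x₀).2 ?_
  obtain ⟨Y, hY, h⟩ := hφ.exists_chart_gradField c x₀
  have hYe : ContMDiffAt (𝓡 m) 𝓘(ℝ, EuclideanSpace ℝ (Fin m)) ∞
      (fun x => Y (extChartAt (𝓡 m) x₀ x)) x₀ :=
    ContMDiffAt.comp x₀ (hY.contDiffAt (extChartAt_target_mem_nhds x₀)).contMDiffAt
      contMDiffAt_extChartAt
  refine hYe.congr_of_eventuallyEq ?_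
  filter_upwards [extChartAt_source_mem_nhds (I := 𝓡 m) x₀] with x hx
  have hx' : x ∈ (chartAt (EuclideanSpace ℝ (Fin m)) x₀).source := by
    rwa [extChartAt_source] at hx
  have htriv : (trivializationAt (EuclideanSpace ℝ (Fin m)) (TangentSpace (𝓡 m)) x₀
        ⟨x, gradField φ c x⟩).2 =
      (trivializationAt (EuclideanSpace ℝ (Fin m)) (TangentSpace (𝓡 m)) x₀).continuousLinearMapAt
        ℝ x (gradField φ c x) := by
    rw [Bundle.Trivialization.continuousLinearMapAt_apply,
      Bundle.Trivialization.linearMapAt_apply, if_pos (by simpa using hx')]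
  rw [htriv, TangentBundle.continuousLinearMapAt_trivializationAt hx']
  exact (h x hx).1

theorem contMDiff_tangentialPart (c : EuclideanSpace ℝ (Fin n)) :
    ContMDiff (𝓡 m) (𝓡 n) ∞ (tangentialPart m φ c) := by
  intro x₀
  obtain ⟨Y, hY, h⟩ := hφ.exists_chart_gradField c x₀
  have hn := extChartAt_target_mem_nhds (I := 𝓡 m) x₀
  have hψd : ContDiffOn ℝ ∞ (φ ∘ (extChartAt (𝓡 m) x₀).symm) (extChartAt (𝓡 m) x₀).target := by
    rw [← contMDiffOn_iff_contDiffOn]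
    exact hφ.contMDiff.comp_contMDiffOn (contMDiffOn_extChartAt_symm x₀)
  have hAd := hψd.fderiv_of_isOpen (isOpen_extChartAt_target x₀) (m := ∞) (by simp)
  have hT := ((hAd.contDiffAt hn).clm_apply (hY.contDiffAt hn)).contMDiffAt
  refine (ContMDiffAt.comp x₀ hT contMDiffAt_extChartAt).congr_of_eventuallyEq ?_
  filter_upwards [extChartAt_source_mem_nhds (I := 𝓡 m) x₀] with x hx
  exact (h x hx).2.1

/-- The derivative of the tangential part of the position vector: its tangential component is
`v` plus the normal component of the position vector paired with the second fundamental form.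
This follows by differentiating `⟪T, dφ w⟫ = ⟪φ - c, dφ w⟫`, for a constant coordinate vector
`w`. -/
theorem inner_mfderiv_tangentialPart (c : EuclideanSpace ℝ (Fin n)) (x : M)
    (v w : TangentSpace (𝓡 m) x) :
    inner ℝ (differential (tangentialPart m φ c) x v) (differential φ x w) =
      inner ℝ v w + inner ℝ (φ x - c) (secondFundamentalForm (m := m) φ x v w) := by
  set e := extChartAt (𝓡 m) x with he
  set ψ : EuclideanSpace ℝ (Fin m) → EuclideanSpace ℝ (Fin n) := φ ∘ e.symm with hψ
  set T : EuclideanSpace ℝ (Fin m) → EuclideanSpace ℝ (Fin n) := tangentialPart m φ c ∘ e.symm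
    with hT
  have hn : e.target ∈ 𝓝 (e x) := extChartAt_target_mem_nhds x
  have hex : e.symm (e x) = x := extChartAt_to_inv x
  have hsm : ContMDiffOn 𝓘(ℝ, EuclideanSpace ℝ (Fin m)) (𝓡 m) ∞ e.symm e.target :=
    contMDiffOn_extChartAt_symm x
  have hψd : ContDiffAt ℝ ∞ ψ (e x) := by
    refine ContDiffOn.contDiffAt ?_ hn
    rw [← contMDiffOn_iff_contDiffOn]
    exact hφ.contMDiff.comp_contMDiffOn hsm
  have hTd : ContDiffAt ℝ ∞ T (e x) := by
    refine ContDiffOn.contDiffAt ?_ hn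
    rw [← contMDiffOn_iff_contDiffOn]
    exact (hφ.contMDiff_tangentialPart c).comp_contMDiffOn hsm
  have hAd : ContDiffAt ℝ ∞ (fderiv ℝ ψ) (e x) := hψd.fderiv_right (by simp)
  have hdφ (u : EuclideanSpace ℝ (Fin m)) : differential φ x u = fderiv ℝ ψ (e x) u := by
    have := mfderiv_eq_fderiv_chart ((hφ.contMDiff x).mdifferentiableAt (by simp))
    exact congrArg (fun L : EuclideanSpace ℝ (Fin m) →L[ℝ] EuclideanSpace ℝ (Fin n) => L u) this
  have hdT (u : EuclideanSpace ℝ (Fin m)) :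
      differential (tangentialPart m φ c) x u = fderiv ℝ T (e x) u := by
    have := mfderiv_eq_fderiv_chart
      ((hφ.contMDiff_tangentialPart c x).mdifferentiableAt (by simp))
    exact congrArg (fun L : EuclideanSpace ℝ (Fin m) →L[ℝ] EuclideanSpace ℝ (Fin n) => L u) this
  let v' : EuclideanSpace ℝ (Fin m) := v
  let w' : EuclideanSpace ℝ (Fin m) := w
  -- The identity to be differentiated holds near the base point.
  have hid : (fun y => inner ℝ (T y) (fderiv ℝ ψ y w')) =ᶠ[𝓝 (e x)]
      fun y => inner ℝ (ψ y - c) (fderiv ℝ ψ y w') := by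
    obtain ⟨Y, hY, h⟩ := hφ.exists_chart_gradField c x
    filter_upwards [hn] with y hy
    have := (h (e.symm y) (e.map_target hy)).2.2 w'
    rwa [← he, e.right_inv hy] at this
  have hd1 : HasFDerivAt T (fderiv ℝ T (e x)) (e x) :=
    (hTd.differentiableAt (by simp)).hasFDerivAt
  have hd2 : HasFDerivAt ψ (fderiv ℝ ψ (e x)) (e x) :=
    (hψd.differentiableAt (by simp)).hasFDerivAt
  have hd3 : HasFDerivAt (fun y => fderiv ℝ ψ y w') _ (e x) :=
    (hAd.differentiableAt (by simp)).hasFDerivAt.clm_apply (hasFDerivAt_const w' (e x))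
  have hder := ((hd1.inner ℝ hd3).congr_of_eventuallyEq hid.symm).unique
    ((hd2.sub_const c).inner ℝ hd3)
  have hder' := congrArg (fun L : EuclideanSpace ℝ (Fin m) →L[ℝ] ℝ => L v') hder
  simp only [ContinuousLinearMap.comp_apply, ContinuousLinearMap.prod_apply, fderivInnerCLM_apply,
    ContinuousLinearMap.comp_zero, zero_add, ContinuousLinearMap.flip_apply] at hder'
  have hTe : T (e x) = tangentialPart m φ c x := congrArg (tangentialPart m φ c) hex
  have hψe : ψ (e x) = φ x := congrArg φ hex
  rw [← hdT v', ← hdφ v', ← hdφ w', hTe, hψe] at hder'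
  have hα := inner_starProjection_orthogonal (K := tangentPlane (m := m) φ x) (a := φ x - c)
    (T := tangentialPart m φ c x) ⟨gradField φ c x, rfl⟩
    (by rintro _ ⟨u, rfl⟩; exact hφ.inner_tangentialPart x u)
    (fderiv ℝ (fderiv ℝ ψ) (e x) v' w')
  have hvw : inner ℝ (differential φ x v') (differential φ x w') = inner ℝ v w :=
    hφ.inner_differential x v w
  rw [hvw] at hder'
  change inner ℝ (differential (tangentialPart m φ c) x v') (differential φ x w') = inner ℝ v w +
    inner ℝ (φ x - c) ((tangentPlane (m := m) φ x)ᗮ.starProjection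
      (fderiv ℝ (fderiv ℝ ψ) (e x) v' w'))
  rw [hα]
  linarith

theorem le_inner_mfderiv_tangentialPart (c : EuclideanSpace ℝ (Fin n)) (x : M)
    (v w : TangentSpace (𝓡 m) x) :
    inner ℝ v w - ‖φ x - c‖ * normSecondFundamentalForm (m := m) φ x * (‖v‖ * ‖w‖) ≤
      inner ℝ (differential (tangentialPart m φ c) x v) (differential φ x w) := by
  rw [hφ.inner_mfderiv_tangentialPart c x v w, mul_assoc]
  have h1 := abs_le.1 (abs_real_inner_le_norm (φ x - c) (secondFundamentalForm (m := m) φ x v w))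
  have h2 : ‖φ x - c‖ * ‖secondFundamentalForm (m := m) φ x v w‖ ≤
      ‖φ x - c‖ * (normSecondFundamentalForm (m := m) φ x * (‖v‖ * ‖w‖)) := by
    gcongr
    exact norm_secondFundamentalForm_le φ x v w
  linarith [h1.1]

/-- Where `|φ - c| |α| < 1`, the derivative of the tangential part of the position vector is
injective, so that its zeros are isolated. -/
theorem eventually_tangentialPart_ne_zero (c : EuclideanSpace ℝ (Fin n)) {q : M}
    (hα : ‖φ q - c‖ * normSecondFundamentalForm (m := m) φ q < 1) :
    ∀ᶠ z in 𝓝[≠] q, tangentialPart m φ c z ≠ 0 := by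
  set e := extChartAt (𝓡 m) q with he
  set T : EuclideanSpace ℝ (Fin m) → EuclideanSpace ℝ (Fin n) := tangentialPart m φ c ∘ e.symm
    with hT
  have hn : e.target ∈ 𝓝 (e q) := extChartAt_target_mem_nhds q
  have hsm : ContMDiffOn 𝓘(ℝ, EuclideanSpace ℝ (Fin m)) (𝓡 m) ∞ e.symm e.target :=
    contMDiffOn_extChartAt_symm q
  have hTd : ContDiffAt ℝ ∞ T (e q) := by
    refine ContDiffOn.contDiffAt ?_ hn
    rw [← contMDiffOn_iff_contDiffOn]
    exact (hφ.contMDiff_tangentialPart c).comp_contMDiffOn hsm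
  have hdT (u : EuclideanSpace ℝ (Fin m)) :
      differential (tangentialPart m φ c) q u = fderiv ℝ T (e q) u := by
    have := mfderiv_eq_fderiv_chart
      ((hφ.contMDiff_tangentialPart c q).mdifferentiableAt (by simp))
    exact congrArg (fun L : EuclideanSpace ℝ (Fin m) →L[ℝ] EuclideanSpace ℝ (Fin n) => L u) this
  have hinj : Function.Injective (fderiv ℝ T (e q)) := by
    rw [injective_iff_map_eq_zero]
    intro u hu
    let v : TangentSpace (𝓡 m) q := u
    have h1 := hφ.le_inner_mfderiv_tangentialPart c q v v
    have h2 : differential (tangentialPart m φ c) q v = 0 := (hdT u).trans hu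
    rw [h2, inner_zero_left, real_inner_self_eq_norm_mul_norm] at h1
    have h3 : ‖v‖ * ‖v‖ = 0 := by nlinarith [mul_self_nonneg ‖v‖]
    have h4 : v = 0 := norm_eq_zero.1 (mul_self_eq_zero.1 h3)
    exact h4
  obtain ⟨C, -, hC⟩ := (fderiv ℝ T (e q)).toLinearMap.exists_antilipschitzWith
    (LinearMap.ker_eq_bot.2 hinj)
  have hne := (hTd.differentiableAt (by simp)).hasFDerivAt.eventually_ne (c := 0)
    ⟨C, hC⟩
  rw [eventually_nhdsWithin_iff] at hne ⊢
  have hc : ContinuousAt e q := continuousAt_extChartAt q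
  filter_upwards [hc.eventually hne, extChartAt_source_mem_nhds (I := 𝓡 m) q] with z hz hzs hzq
  have := hz (fun h => hzq (e.injOn hzs (mem_extChartAt_source q) h))
  rwa [hT, Function.comp_apply, e.left_inv hzs] at this

end IsIsometricImmersion

end Gradient

end ImmersedSubmanifold

/-! ### Flows whose trajectories are bounded in length by a decreasing function -/

namespace MetricFlow

variable {M : Type*} [MetricSpace M] {Φ : M × ℝ → M}

/-- Along every piece of a trajectory of `Φ` that avoids `C`, the function `F` decreases by at
least the distance between the end points. -/
def DecreasesOff (Φ : M × ℝ → M) (C : Set M) (F : M → ℝ) : Prop :=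
  ∀ x s t, s ≤ t → (∀ r ∈ Ioo s t, Φ (x, r) ∉ C) →
    dist (Φ (x, s)) (Φ (x, t)) ≤ F (Φ (x, s)) - F (Φ (x, t))

/-- The point where a trajectory first enters `C` is within distance `F` of the starting point. -/
theorem DecreasesOff.exists_dist_le_of_hit {C : Set M} {F : M → ℝ} (hD : DecreasesOff Φ C F)
    (hΦ : Continuous Φ) (h0 : ∀ x, Φ (x, 0) = x) (hC : IsClosed C) (hF : ∀ x, 0 ≤ F x) {x : M}
    {t : ℝ} (ht : 0 ≤ t) (hx : Φ (x, t) ∈ C) : ∃ y ∈ C, dist x y ≤ F x := by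
  have hcont : Continuous fun r : ℝ => Φ (x, r) := by fun_prop
  obtain ⟨s, ⟨hs, hsC⟩, hmin⟩ := (isCompact_Icc.inter_right (hC.preimage hcont)).exists_isLeast
    (s := Icc 0 t ∩ (fun r : ℝ => Φ (x, r)) ⁻¹' C) ⟨t, ⟨ht, le_rfl⟩, hx⟩
  refine ⟨Φ (x, s), hsC, ?_⟩
  have := hD x 0 s hs.1 fun r hr hrC => hr.2.not_ge (hmin ⟨⟨hr.1.le, hr.2.le.trans hs.2⟩, hrC⟩)
  rw [h0] at this
  linarith [hF (Φ (x, s))]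

/-- A trajectory that avoids `C` converges to a stationary point: its length is controlled by the
bounded decreasing quantity `F`. -/
theorem DecreasesOff.exists_tendsto [CompleteSpace M] {C : Set M} {F : M → ℝ}
    (hD : DecreasesOff Φ C F) (hΦ : Continuous Φ) (h0 : ∀ x, Φ (x, 0) = x)
    (hadd : ∀ x s t, Φ (Φ (x, s), t) = Φ (x, t + s)) (hF : ∀ x, 0 ≤ F x) {x : M}
    (hx : ∀ t, 0 < t → Φ (x, t) ∉ C) :
    ∃ q, Tendsto (fun t => Φ (x, t)) atTop (𝓝 q) ∧ (∀ t, Φ (q, t) = q) ∧ dist x q ≤ F x := by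
  -- replacing `t` by `max t 0` makes the estimates hold on all of `ℝ`
  set u : ℝ → M := fun t => Φ (x, max t 0) with hu
  have hle (s t : ℝ) (hst : s ≤ t) : dist (u s) (u t) ≤ F (u s) - F (u t) :=
    hD x _ _ (max_le_max_right 0 hst) fun r hr => hx r ((le_max_right _ _).trans_lt hr.1)
  have hanti : Antitone (fun t => F (u t)) := fun s t hst => by
    linarith [hle s t hst, dist_nonneg (x := u s) (y := u t)]
  have hlim := tendsto_atTop_ciInf hanti ⟨0, by rintro _ ⟨t, rfl⟩; exact hF _⟩
  set L := ⨅ t, F (u t) with hL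
  have hLle (t : ℝ) : L ≤ F (u t) := hanti.le_of_tendsto hlim t
  have hcau : CauchySeq u := by
    refine cauchySeq_of_le_tendsto_0 (fun N => 2 * (F (u N) - L)) (fun s t N hs ht => ?_) ?_
    · have h1 := hle N s hs
      have h2 := hle N t ht
      rw [dist_comm] at h1
      linarith [dist_triangle (u s) (u N) (u t), hLle s, hLle t]
    · simpa using (hlim.sub_const L).const_mul 2
  obtain ⟨q, hq⟩ := cauchySeq_tendsto_of_complete hcau
  have hq' : Tendsto (fun t => Φ (x, t)) atTop (𝓝 q) := by
    refine hq.congr' ?_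
    filter_upwards [eventually_ge_atTop 0] with t ht
    simp [hu, max_eq_left ht]
  refine ⟨q, hq', fun s => ?_, ?_⟩
  · have h1 : Tendsto (fun t => Φ (x, t + s)) atTop (𝓝 q) :=
      hq'.comp (tendsto_atTop_add_const_right _ s tendsto_id)
    have h2 : Tendsto (fun t => Φ (Φ (x, t), s)) atTop (𝓝 (Φ (q, s))) :=
      ((by fun_prop : Continuous fun y => Φ (y, s)).tendsto q).comp hq'
    simp only [hadd, add_comm s] at h2
    exact tendsto_nhds_unique h2 h1
  · have hd : Tendsto (fun t => dist x (Φ (x, t))) atTop (𝓝 (dist x q)) :=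
      tendsto_const_nhds.dist hq'
    refine le_of_tendsto hd ?_
    filter_upwards [eventually_ge_atTop 0] with t ht
    have := hD x 0 t ht fun r hr => hx r hr.1
    rw [h0] at this
    linarith [hF (Φ (x, t))]

/-- From every point one reaches either `C` or a stationary point within distance `F`. -/
theorem DecreasesOff.exists_dist_le [CompleteSpace M] {C : Set M} {F : M → ℝ}
    (hD : DecreasesOff Φ C F) (hΦ : Continuous Φ) (h0 : ∀ x, Φ (x, 0) = x)
    (hadd : ∀ x s t, Φ (Φ (x, s), t) = Φ (x, t + s)) (hC : IsClosed C) (hF : ∀ x, 0 ≤ F x)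
    (x : M) : ∃ y, dist x y ≤ F x ∧ (y ∈ C ∨ ∀ t, Φ (y, t) = y) := by
  by_cases h : ∃ t, 0 < t ∧ Φ (x, t) ∈ C
  · obtain ⟨t, ht, hx⟩ := h
    obtain ⟨y, hy, hxy⟩ := hD.exists_dist_le_of_hit hΦ h0 hC hF ht.le hx
    exact ⟨y, hxy, .inl hy⟩
  · push Not at h
    obtain ⟨q, -, hq, hxq⟩ := hD.exists_tendsto hΦ h0 hadd hF h
    exact ⟨q, hxq, .inr hq⟩

/-- The basin of attraction of an isolated zero `q` of `F` outside `C` is open: a trajectory that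
starts near `q` moves by at most the small value of `F` there, so it avoids `C` and its limit
is `q`. -/
theorem DecreasesOff.isOpen_basin [CompleteSpace M] {C : Set M} {F : M → ℝ}
    (hD : DecreasesOff Φ C F) (hΦ : Continuous Φ) (h0 : ∀ x, Φ (x, 0) = x)
    (hadd : ∀ x s t, Φ (Φ (x, s), t) = Φ (x, t + s)) (hC : IsClosed C) (hF : ∀ x, 0 ≤ F x)
    (hFc : Continuous F) (hstat : ∀ x, (∀ t, Φ (x, t) = x) → F x = 0) {q : M} (hqC : q ∉ C)
    (hq0 : F q = 0) (hiso : ∀ᶠ z in 𝓝[≠] q, F z ≠ 0) :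
    IsOpen {x | Tendsto (fun t => Φ (x, t)) atTop (𝓝 q)} := by
  obtain ⟨r, hr, hball⟩ := Metric.eventually_nhds_iff.1
    ((eventually_nhdsWithin_iff.1 hiso).and (hC.isOpen_compl.mem_nhds hqC))
  set U := Metric.ball q (r / 2) ∩ {z | F z < r / 2} with hU
  have hUo : IsOpen U := Metric.isOpen_ball.inter (isOpen_lt hFc continuous_const)
  have hqU : q ∈ U := ⟨Metric.mem_ball_self (by positivity), by simp [hq0, hr]⟩
  have hUb (z : M) (hz : z ∈ U) : Tendsto (fun t => Φ (z, t)) atTop (𝓝 q) := by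
    have hzq : dist z q < r / 2 := hz.1
    have hFz : F z < r / 2 := hz.2
    obtain ⟨q', hq', hfix, hd⟩ := hD.exists_tendsto hΦ h0 hadd hF (x := z) fun t ht htC => by
      obtain ⟨y, hyC, hy⟩ := hD.exists_dist_le_of_hit hΦ h0 hC hF ht.le htC
      refine (hball (y := y) ?_).2 hyC
      linarith [dist_triangle_left y q z]
    have : q' = q := by
      by_contra hne
      refine (hball (y := q') ?_).1 hne (hstat q' hfix)
      linarith [dist_triangle_left q' q z]
    rwa [this] at hq'
  refine isOpen_iff_mem_nhds.2 fun x hx => ?_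
  obtain ⟨t, ht⟩ := (hx.eventually (hUo.mem_nhds hqU)).exists
  have hct : Continuous fun y => Φ (y, t) := by fun_prop
  filter_upwards [hct.continuousAt.preimage_mem_nhds (hUo.mem_nhds ht)] with y hy
  have h1 := (hUb _ hy).comp (tendsto_atTop_add_const_right atTop (-t) tendsto_id)
  refine h1.congr fun s => ?_
  simp [hadd]

/-- If all zeros of `F` outside `C` are isolated and `M` is connected, all stationary points of the
flow lie within a bounded distance of `C`: the basin of a stationary point farther away would be
open and closed, but would not contain the points of `C`. -/
theorem DecreasesOff.dist_le_of_stationary [CompleteSpace M] [PreconnectedSpace M]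
    {C C' : Set M} {F : M → ℝ}
    (hD : DecreasesOff Φ C F) (hΦ : Continuous Φ) (h0 : ∀ x, Φ (x, 0) = x)
    (hadd : ∀ x s t, Φ (Φ (x, s), t) = Φ (x, t + s)) (hC : IsClosed C) (hF : ∀ x, 0 ≤ F x)
    (hFc : Continuous F) (hstat : ∀ x, (∀ t, Φ (x, t) = x) ↔ F x = 0)
    (hiso : ∀ q, q ∉ C → F q = 0 → ∀ᶠ z in 𝓝[≠] q, F z ≠ 0)
    (hC' : IsClosed C') (hCC' : C ⊆ interior C') {p : M} (hp : p ∈ C) {A B : ℝ}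
    (hA : ∀ x ∈ C', dist p x ≤ A) (hB : ∀ x ∈ C', F x ≤ B) {q : M} (hq : F q = 0) :
    dist p q ≤ A + B := by
  by_contra! hlt
  have hB0 : 0 ≤ B := (hF p).trans (hB p (interior_subset (hCC' hp)))
  have hqC : q ∉ C := fun h => by linarith [hA q (interior_subset (hCC' h))]
  set O := interior C' with hO
  -- a trajectory that has met `O` stays at distance at most `A + B` from `p`
  have hnear (x : M) (t s : ℝ) (hts : t ≤ s) (hx : Φ (x, t) ∈ C') :
      dist p (Φ (x, s)) ≤ A + B := by
    have hcont : Continuous fun r : ℝ => Φ (x, r) := by fun_prop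
    obtain ⟨r, ⟨hr, hrC⟩, hmax⟩ := (isCompact_Icc.inter_right
      (hC'.preimage hcont)).exists_isGreatest
      (s := Icc t s ∩ (fun r : ℝ => Φ (x, r)) ⁻¹' C') ⟨t, ⟨le_rfl, hts⟩, hx⟩
    have h1 := hD x r s hr.2 fun a ha haC => ha.1.not_ge
      (hmax ⟨⟨hr.1.trans ha.1.le, ha.2.le⟩, (interior_subset (hCC' haC) : Φ (x, a) ∈ C')⟩)
    linarith [dist_triangle p (Φ (x, r)) (Φ (x, s)), hA _ hrC, hB _ hrC, hF (Φ (x, s))]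
  set basin : M → Set M := fun q => {x | Tendsto (fun t => Φ (x, t)) atTop (𝓝 q)} with hbasin
  have hmeets (x : M) (hx : ∃ t, 0 ≤ t ∧ Φ (x, t) ∈ O) : x ∉ basin q := fun hxq => by
    obtain ⟨t, -, ht⟩ := hx
    refine hlt.not_ge (le_of_tendsto (tendsto_const_nhds.dist hxq) ?_)
    filter_upwards [eventually_ge_atTop t] with s hs
    exact hnear x t s hs (interior_subset ht)
  have hstat' := fun x => (hstat x).1
  have hopen (q : M) (hqC : q ∉ C) (hq : F q = 0) : IsOpen (basin q) :=
    hD.isOpen_basin hΦ h0 hadd hC hF hFc hstat' hqC hq (hiso q hqC hq)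
  have hclosed : IsClosed (basin q) := by
    rw [← isOpen_compl_iff, isOpen_iff_mem_nhds]
    intro x hx
    by_cases hxO : ∃ t, 0 ≤ t ∧ Φ (x, t) ∈ O
    · obtain ⟨t, ht0, ht⟩ := hxO
      have hct : Continuous fun y => Φ (y, t) := by fun_prop
      filter_upwards [hct.continuousAt.preimage_mem_nhds (isOpen_interior.mem_nhds ht)] with y hy
      exact hmeets y ⟨t, ht0, hy⟩
    · push Not at hxO
      obtain ⟨q', hq', hfix, -⟩ := hD.exists_tendsto hΦ h0 hadd hF (x := x)
        fun t ht h => hxO t ht.le (hCC' h)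
      have hq'C : q' ∉ C := fun h => by
        obtain ⟨t, ht, ht0⟩ := ((hq'.eventually (isOpen_interior.mem_nhds (hCC' h))).and
          (eventually_ge_atTop 0)).exists
        exact hxO t ht0 ht
      filter_upwards [(hopen q' hq'C (hstat' q' hfix)).mem_nhds hq'] with y hy hyq
      have : q' = q := tendsto_nhds_unique hy hyq
      exact hx (this ▸ hq')
  have huniv : basin q = univ := IsClopen.eq_univ ⟨hclosed, hopen q hqC hq⟩
    ⟨q, by
      change Tendsto (fun t => Φ (q, t)) atTop (𝓝 q)
      simp only [(hstat q).2 hq, tendsto_const_nhds]⟩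
  exact hmeets p ⟨0, le_rfl, by rw [h0]; exact hCC' hp⟩ (huniv ▸ mem_univ p)

end MetricFlow

/-! ### Multiples of the gradient field and their flows -/

namespace ImmersedSubmanifold

open SmoothFlow RiemannianGeometry MetricFlow

/-- The function `x ↦ ‖φ x - c‖² / 2` on `M`. -/
def halfSqDist {n : ℕ} {M : Type*} (φ : M → EuclideanSpace ℝ (Fin n))
    (c : EuclideanSpace ℝ (Fin n)) (x : M) : ℝ :=
  ‖φ x - c‖ ^ 2 / 2

theorem halfSqDist_nonneg {n : ℕ} {M : Type*} (φ : M → EuclideanSpace ℝ (Fin n))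
    (c : EuclideanSpace ℝ (Fin n)) (x : M) : 0 ≤ halfSqDist φ c x := by
  unfold halfSqDist
  positivity

section Smooth

variable {m n : ℕ} {M : Type*} [TopologicalSpace M] [ChartedSpace (EuclideanSpace ℝ (Fin m)) M]

theorem hasDerivAt_comp_integralCurve {k : ℕ} {F : M → EuclideanSpace ℝ (Fin k)}
    (hF : MDifferentiable (𝓡 m) (𝓡 k) F) {v : (x : M) → TangentSpace (𝓡 m) x} {γ : ℝ → M}
    (hγ : IsMIntegralCurve γ v) (t : ℝ) :
    HasDerivAt (F ∘ γ) (differential F (γ t) (v (γ t))) t := by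
  have h : HasFDerivAt (𝕜 := ℝ) (E := ℝ) (F := EuclideanSpace ℝ (Fin k)) (F ∘ γ) _ t :=
    ((hF (γ t)).hasMFDerivAt.comp t (hγ t)).hasFDerivAt
  refine h.hasDerivAt.congr_deriv ?_
  change mfderiv (𝓡 m) (𝓡 k) F (γ t) ((1 : ℝ) • v (γ t)) = _
  rw [one_smul]
  rfl

variable [IsManifold (𝓡 m) ∞ M] [Bundle.RiemannianBundle (fun x : M => TangentSpace (𝓡 m) x)]
  {φ : M → EuclideanSpace ℝ (Fin n)} (hφ : IsIsometricImmersion (m := m) φ)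
  (c : EuclideanSpace ℝ (Fin n))

namespace IsIsometricImmersion

include hφ

omit [IsManifold (𝓡 m) ∞ M] in
theorem contMDiff_halfSqDist : ContMDiff (𝓡 m) 𝓘(ℝ, ℝ) ∞ (halfSqDist φ c) := by
  have h : ContDiff ℝ ∞ (fun y : EuclideanSpace ℝ (Fin n) => ‖y - c‖ ^ 2 / 2) :=
    ((contDiff_id.sub contDiff_const).norm_sq ℝ).div_const _
  exact h.contMDiff.comp hφ.contMDiff

theorem contMDiff_smul_gradField {g : M → ℝ} (hg : ContMDiff (𝓡 m) 𝓘(ℝ, ℝ) ∞ g) :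
    ContMDiff (𝓡 m) (𝓡 m).tangent ∞
      (fun x => (⟨x, g x • gradField φ c x⟩ : TangentBundle (𝓡 m) M)) :=
  hg.smul_section (hφ.contMDiff_gradField c)

variable {c}

omit [IsManifold (𝓡 m) ∞ M] in
theorem hasDerivAt_halfSqDist {g : M → ℝ} {γ : ℝ → M}
    (hγ : IsMIntegralCurve γ (fun x => g x • gradField (m := m) φ c x)) (t : ℝ) :
    HasDerivAt (fun t => halfSqDist φ c (γ t)) (g (γ t) * ‖tangentialPart m φ c (γ t)‖ ^ 2) t := by
  have h := ((hasDerivAt_comp_integralCurve (hφ.contMDiff.mdifferentiable (by simp)) hγ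
    t).sub_const c).norm_sq.div_const 2
  refine h.congr_deriv ?_
  rw [map_smul, inner_smul_right, Function.comp_apply, ← inner_gradField,
    real_inner_self_eq_norm_sq, hφ.norm_tangentialPart]
  ring

theorem hasDerivAt_norm_tangentialPart {g : M → ℝ} {γ : ℝ → M}
    (hγ : IsMIntegralCurve γ (fun x => g x • gradField (m := m) φ c x)) {t : ℝ}
    (ht : tangentialPart m φ c (γ t) ≠ 0) :
    HasDerivAt (fun t => ‖tangentialPart m φ c (γ t)‖)
      (g (γ t) * (inner ℝ (differential (m := m) (tangentialPart m φ c) (γ t) (gradField φ c (γ t)))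
        (differential (m := m) φ (γ t) (gradField φ c (γ t))) / ‖tangentialPart m φ c (γ t)‖)) t := by
  have h := (hasDerivAt_comp_integralCurve
    ((hφ.contMDiff_tangentialPart c).mdifferentiable (by simp)) hγ t).norm_sq.sqrt
    (by simpa using ht)
  simp only [Real.sqrt_sq (norm_nonneg _), Function.comp_apply] at h
  refine h.congr_deriv ?_
  rw [map_smul, inner_smul_right, real_inner_comm]
  rw [show differential φ (γ t) (gradField φ c (γ t)) = tangentialPart m φ c (γ t) from rfl]
  field_simp

end IsIsometricImmersion

end Smooth

variable {m n : ℕ} {M : Type*} [MetricSpace M] [ChartedSpace (EuclideanSpace ℝ (Fin m)) M]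
  [IsManifold (𝓡 m) ∞ M]
  [Bundle.RiemannianBundle (fun x : M => TangentSpace (𝓡 m) x)]
  [IsRiemannianManifold (𝓡 m) M]
  {φ : M → EuclideanSpace ℝ (Fin n)} (hφ : IsIsometricImmersion (m := m) φ)

namespace IsIsometricImmersion

include hφ in
theorem norm_sub_le_dist (x y : M) : ‖φ x - φ y‖ ≤ dist x y := by
  have : IsManifold (𝓡 m) 1 M := .of_le (n := ∞) (by simp)
  rw [← dist_eq_norm]
  exact dist_map_le (hφ.contMDiff.of_le (by simp)) (fun x w => hφ.norm_differential x w) x y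

variable (m φ) in
/-- The factor that turns the gradient into a field of norm at most `1` pointing downwards. -/
def descentFactor (c : EuclideanSpace ℝ (Fin n)) (x : M) : ℝ :=
  -(1 / √(1 + ‖tangentialPart m φ c x‖ ^ 2))

variable (m φ) in
/-- The bounded descent field `-X / √(1 + ‖X‖²)`, for `X = gradField φ c`. -/
def descentField (c : EuclideanSpace ℝ (Fin n)) (x : M) : TangentSpace (𝓡 m) x :=
  descentFactor m φ c x • gradField φ c x

variable {c : EuclideanSpace ℝ (Fin n)}

omit [IsManifold (𝓡 m) ∞ M] [IsRiemannianManifold (𝓡 m) M] in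
theorem descentFactor_neg (x : M) : descentFactor m φ c x < 0 := by
  unfold descentFactor
  have : 0 < √(1 + ‖tangentialPart m φ c x‖ ^ 2) := Real.sqrt_pos.2 (by positivity)
  simpa using this

include hφ

omit [IsManifold (𝓡 m) ∞ M] [IsRiemannianManifold (𝓡 m) M] in
theorem norm_descentField (x : M) :
    ‖descentField m φ c x‖ = -descentFactor m φ c x * ‖tangentialPart m φ c x‖ := by
  rw [descentField, norm_smul, Real.norm_of_nonpos (descentFactor_neg x).le,
    hφ.norm_tangentialPart]

omit [IsManifold (𝓡 m) ∞ M] [IsRiemannianManifold (𝓡 m) M] in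
theorem norm_descentField_le (x : M) : ‖descentField m φ c x‖ ≤ 1 := by
  rw [hφ.norm_descentField, descentFactor, neg_neg, one_div_mul_eq_div]
  refine div_le_one_of_le₀ (Real.le_sqrt_of_sq_le (by linarith)) (Real.sqrt_nonneg _)

omit [IsRiemannianManifold (𝓡 m) M] in
theorem contMDiff_descentField (c : EuclideanSpace ℝ (Fin n)) :
    ContMDiff (𝓡 m) (𝓡 m).tangent ∞
      (fun x => (⟨x, descentField m φ c x⟩ : TangentBundle (𝓡 m) M)) := by
  refine hφ.contMDiff_smul_gradField c ?_
  have h : ContDiff ℝ ∞ (fun y : EuclideanSpace ℝ (Fin n) => -(1 / √(1 + ‖y‖ ^ 2))) := by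
    refine (contDiff_const.div ((contDiff_const.add (contDiff_id.norm_sq ℝ)).sqrt fun y => ?_)
      fun y => ?_).neg
    · exact (by positivity : 0 < 1 + ‖y‖ ^ 2).ne'
    · exact (Real.sqrt_pos.2 (by positivity : 0 < 1 + ‖y‖ ^ 2)).ne'
  exact h.contMDiff.comp (hφ.contMDiff_tangentialPart c)

theorem isCompleteField_descentField [CompleteSpace M] (c : EuclideanSpace ℝ (Fin n)) :
    IsCompleteField (descentField m φ c) :=
  isCompleteField_of_bounded (hφ.contMDiff_descentField c) hφ.norm_descentField_le

section Descent

variable (h : IsCompleteField (descentField m φ c))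

omit [IsRiemannianManifold (𝓡 m) M] in
/-- The stationary points of the descent flow are the zeros of the gradient, since `halfSqDist φ c`
is strictly decreasing along all other trajectories. -/
theorem flow_descentField_stationary_iff (x : M) :
    (∀ t, flow h (x, t) = x) ↔ tangentialPart m φ c x = 0 := by
  refine ⟨fun hx => ?_, fun hx t => ?_⟩
  · have h1 := hφ.hasDerivAt_halfSqDist (isMIntegralCurve_flow h x) 0
    simp only [hx] at h1
    have h2 := h1.unique (hasDerivAt_const 0 (halfSqDist φ c x))
    simpa [(descentFactor_neg (m := m) (φ := φ) (c := c) x).ne] using h2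
  · refine flow_eq_of_eq_zero (hφ.contMDiff_descentField c) h ?_ t
    rw [← norm_eq_zero, hφ.norm_descentField, hx, norm_zero, mul_zero]

omit [IsRiemannianManifold (𝓡 m) M] in
theorem contMDiffOn_flow_descentField (x : M) (s t : ℝ) :
    ContMDiffOn 𝓘(ℝ, ℝ) (𝓡 m) 1 (fun t => flow h (x, t)) (Icc s t) := fun r _ =>
  ((contMDiffAt_of_isMIntegralCurveAt (hφ.contMDiff_descentField c)
    ((isMIntegralCurve_flow h x).isMIntegralCurveAt r)).of_le (by simp)).contMDiffWithinAt

/-- Off the set `C`, the length of the tangential part of the position vector decreases along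
the descent flow at a definite fraction of the speed. -/
theorem decreasesOff_norm_tangentialPart {C : Set M} {a : ℝ} (ha : a < 1)
    (hC : ∀ x ∉ C, ‖φ x - c‖ * normSecondFundamentalForm (m := m) φ x ≤ a) :
    DecreasesOff (flow h) C (fun x => ‖tangentialPart m φ c x‖ / (1 - a)) := by
  intro x s t hst hx
  have ha' : 0 < 1 - a := by linarith
  by_cases hx0 : tangentialPart m φ c x = 0
  · simp [(hφ.flow_descentField_stationary_iff h x).2 hx0]
  have hne (r : ℝ) : tangentialPart m φ c (flow h (x, r)) ≠ 0 := fun h0 => by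
    have h1 := (hφ.flow_descentField_stationary_iff h _).2 h0 (-r)
    rw [flow_flow (hφ.contMDiff_descentField c), neg_add_cancel, flow_zero] at h1
    exact hx0 (h1 ▸ h0)
  have hder (r : ℝ) := ((hφ.hasDerivAt_norm_tangentialPart (isMIntegralCurve_flow h x)
    (hne r)).div_const (1 - a)).neg
  have := dist_le_sub_of_speed_le hst (hφ.contMDiffOn_flow_descentField h x s t)
    (γ' := fun r => descentField m φ c (flow h (x, r)))
    (fun r _ => isMIntegralCurve_flow h x r)
    (fun r _ => (hder r).continuousAt.continuousWithinAt) (fun r _ => hder r) fun r hr => ?_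
  · simp only [Pi.neg_apply] at this
    linarith
  · set y := flow h (x, r) with hy
    have h1 := hφ.le_inner_mfderiv_tangentialPart c y (gradField φ c y) (gradField φ c y)
    rw [real_inner_self_eq_norm_mul_norm, ← hφ.norm_tangentialPart] at h1
    have hT : 0 < ‖tangentialPart m φ c y‖ := norm_pos_iff.2 (hne r)
    have h2 := mul_le_mul_of_nonneg_right (hC y (hx r hr)) (mul_self_nonneg
      ‖tangentialPart m φ c y‖)
    rw [hφ.norm_descentField, ← neg_div, le_div_iff₀ ha', ← neg_mul, mul_assoc]
    have h3 := descentFactor_neg (m := m) (φ := φ) (c := c) y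
    refine mul_le_mul_of_nonneg_left ?_ (by linarith)
    rw [le_div_iff₀ hT]
    linarith

/-- Off a set outside of which the gradient has norm at least `1`, the function `halfSqDist φ c`
decreases along the descent flow at least at the rate of the speed. -/
theorem decreasesOff_halfSqDist {C : Set M} (hC : ∀ x ∉ C, 1 ≤ ‖tangentialPart m φ c x‖) :
    DecreasesOff (flow h) C (halfSqDist φ c) := by
  intro x s t hst hx
  have hder (r : ℝ) := (hφ.hasDerivAt_halfSqDist (isMIntegralCurve_flow h x) r).neg
  have := dist_le_sub_of_speed_le hst (hφ.contMDiffOn_flow_descentField h x s t)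
    (γ' := fun r => descentField m φ c (flow h (x, r)))
    (fun r _ => isMIntegralCurve_flow h x r)
    (fun r _ => (hder r).continuousAt.continuousWithinAt) (fun r _ => hder r) fun r hr => ?_
  · simp only [Pi.neg_apply] at this
    linarith
  · rw [hφ.norm_descentField, ← neg_mul]
    have h3 := descentFactor_neg (m := m) (φ := φ) (c := c) (flow h (x, r))
    refine mul_le_mul_of_nonneg_left ?_ (by linarith)
    nlinarith [hC _ (hx r hr)]

end Descent

end IsIsometricImmersion

end ImmersedSubmanifold

/-! ### Growth of the distance function of `ℝⁿ` on the submanifold -/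

namespace ImmersedSubmanifold

open SmoothFlow RiemannianGeometry MetricFlow

variable {m n : ℕ} {M : Type*} [MetricSpace M] [CompleteSpace M]
  [ChartedSpace (EuclideanSpace ℝ (Fin m)) M]
  [Bundle.RiemannianBundle (fun x : M => TangentSpace (𝓡 m) x)]
  {φ : M → EuclideanSpace ℝ (Fin n)}

omit [CompleteSpace M] in
theorem exists_compact_decay {p : M} {K : CompactExhaustion M}
    (ha : decayRate (m := m) φ p K < 1) : ∃ i, p ∈ K i ∧ ∃ a < 1, ∀ x ∉ K i,
      dist p x * normSecondFundamentalForm (m := m) φ x ≤ a := by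
  obtain ⟨i, hi⟩ := iInf_lt_iff.1 ha
  obtain ⟨j, hj⟩ := K.exists_mem p
  refine ⟨max i j, K.subset (le_max_right i j) hj, (decaySup (m := m) φ p K i).toReal, ?_,
    fun x hx => ?_⟩
  · exact ENNReal.toReal_lt_of_lt_ofReal (by simpa using hi)
  · rw [← ENNReal.ofReal_le_iff_le_toReal hi.ne_top]
    exact le_iSup₂ (f := fun x (_ : x ∈ (K i)ᶜ) =>
      ENNReal.ofReal (dist p x * normSecondFundamentalForm (m := m) φ x)) x
      fun h => hx (K.subset (le_max_left i j) h)

variable [IsManifold (𝓡 m) ∞ M] [IsRiemannianManifold (𝓡 m) M]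

/-- The gradient of `halfSqDist φ (φ p)` has norm at least `1` far from `p`, and this function
grows at least linearly with the distance to `p`. -/
theorem IsIsometricImmersion.exists_growth_bound (hφ : IsIsometricImmersion (m := m) φ)
    {p : M} {K : CompactExhaustion M} (ha : decayRate (m := m) φ p K < 1) :
    ∃ R, (∀ x, R ≤ dist p x → 1 ≤ ‖tangentialPart m φ (φ p) x‖) ∧
      ∀ x, dist p x - R ≤ halfSqDist φ (φ p) x := by
  have : PreconnectedSpace M := preconnectedSpace (𝓡 m)
  obtain ⟨i, hpi, a, ha1, hdecay⟩ := exists_compact_decay ha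
  have hα (x : M) (hx : x ∉ K i) :
      ‖φ x - φ p‖ * normSecondFundamentalForm (m := m) φ x ≤ a := by
    refine le_trans ?_ (hdecay x hx)
    rw [dist_comm]
    exact mul_le_mul_of_nonneg_right (hφ.norm_sub_le_dist x p) (Real.sqrt_nonneg _)
  have ha' : 0 < 1 - a := by linarith
  obtain ⟨A, hA⟩ := (K.isCompact (i + 1)).isBounded.subset_closedBall p
  replace hA (x : M) (hx : x ∈ K (i + 1)) : dist p x ≤ A := by
    rw [dist_comm]; exact hA hx
  have hT (x : M) : ‖tangentialPart m φ (φ p) x‖ ≤ dist p x :=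
    (hφ.norm_tangentialPart_le x).trans ((hφ.norm_sub_le_dist x p).trans_eq (dist_comm _ _))
  have h := hφ.isCompleteField_descentField (φ p)
  have hv := hφ.contMDiff_descentField (φ p)
  have hΦ : Continuous (flow h) := (contMDiff_flow hv h).continuous
  have hadd := flow_flow hv h
  have hstat := hφ.flow_descentField_stationary_iff h
  have hTc : Continuous (tangentialPart m φ (φ p)) :=
    (hφ.contMDiff_tangentialPart (φ p)).continuous
  have hD := hφ.decreasesOff_norm_tangentialPart h ha1 hα
  set F : M → ℝ := fun x => ‖tangentialPart m φ (φ p) x‖ / (1 - a) with hF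
  have hF0 (x : M) : 0 ≤ F x := by positivity
  have hFz (x : M) : F x = 0 ↔ tangentialPart m φ (φ p) x = 0 := by simp [hF, ha'.ne']
  set R₂ := A + A / (1 - a) with hR₂
  -- the neighbourhood `K (i + 1)` of `K i` is contained in the ball of radius `A`, where `F` is at
  -- most `A / (1 - a)`
  have hzero (q : M) (hq : F q = 0) : dist p q ≤ R₂ :=
    hD.dist_le_of_stationary hΦ (flow_zero h) hadd (K.isCompact i).isClosed hF0
      (hTc.norm.div_const _) (fun x => (hstat x).trans (hFz x).symm)
      (fun q hqK _ => (hφ.eventually_tangentialPart_ne_zero (φ p)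
        ((hα q hqK).trans_lt ha1)).mono fun z hz hz0 => hz ((hFz z).1 hz0))
      (K.isCompact (i + 1)).isClosed (K.subset_interior_succ i) hpi hA
      (fun x hx => by
        have := (hT x).trans (hA x hx)
        simp only [hF]
        gcongr) hq
  have hA0 : 0 ≤ A := dist_nonneg.trans (hA p (K.subset_succ i hpi))
  have hAR : A ≤ R₂ := by
    have : 0 ≤ A / (1 - a) := by positivity
    linarith
  have hlow (x : M) : dist p x - R₂ ≤ F x := by
    obtain ⟨y, hxy, hy⟩ := hD.exists_dist_le hΦ (flow_zero h) hadd (K.isCompact i).isClosed hF0 x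
    have hpy : dist p y ≤ R₂ := by
      rcases hy with hy | hy
      · exact (hA y (K.subset_succ i hy)).trans hAR
      · exact hzero y ((hFz y).2 ((hstat y).1 hy))
    linarith [dist_triangle_right p x y]
  have hfar (x : M) (hx : R₂ + 1 / (1 - a) ≤ dist p x) : 1 ≤ ‖tangentialPart m φ (φ p) x‖ := by
    have h1 : 1 / (1 - a) ≤ F x := by linarith [hlow x]
    exact (div_le_div_iff_of_pos_right ha').1 h1
  refine ⟨R₂ + 1 / (1 - a), hfar, fun x => ?_⟩
  -- descending from `x`, one reaches the ball of radius `R₂ + 1 / (1 - a)`, which contains all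
  -- stationary points
  obtain ⟨y, hxy, hy⟩ := (hφ.decreasesOff_halfSqDist h
    (C := Metric.closedBall p (R₂ + 1 / (1 - a))) fun x hx => hfar x (by
      rw [Metric.mem_closedBall, dist_comm] at hx; linarith)).exists_dist_le hΦ (flow_zero h) hadd
      Metric.isClosed_closedBall (halfSqDist_nonneg φ (φ p)) x
  have hpy : dist p y ≤ R₂ + 1 / (1 - a) := by
    rcases hy with hy | hy
    · rwa [Metric.mem_closedBall, dist_comm] at hy
    · have := hzero y ((hFz y).2 ((hstat y).1 hy))
      have : 0 < 1 / (1 - a) := by positivity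
      linarith
  linarith [dist_triangle_right p x y]

omit [IsManifold (𝓡 m) ∞ M] in
theorem IsIsometricImmersion.isCompact_halfSqDist_le (hφ : IsIsometricImmersion (m := m) φ)
    {p : M} {R : ℝ} (hR : ∀ x, dist p x - R ≤ halfSqDist φ (φ p) x) (b : ℝ) :
    IsCompact {x | halfSqDist φ (φ p) x ≤ b} := by
  have : ProperSpace M := properSpace_of_complete (𝓡 m)
  refine (isCompact_closedBall p (b + R)).of_isClosed_subset
    (isClosed_le (hφ.contMDiff_halfSqDist (φ p)).continuous continuous_const) fun x hx => ?_
  rw [Metric.mem_closedBall, dist_comm]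
  have hx' : halfSqDist φ (φ p) x ≤ b := hx
  linarith [hR x]

omit [IsManifold (𝓡 m) ∞ M] in
theorem IsIsometricImmersion.isProperMap (hφ : IsIsometricImmersion (m := m) φ)
    {p : M} {R : ℝ} (hR : ∀ x, dist p x - R ≤ halfSqDist φ (φ p) x) : IsProperMap φ := by
  refine isProperMap_iff_isCompact_preimage.2 ⟨hφ.contMDiff.continuous, fun S hS => ?_⟩
  obtain ⟨r, hr⟩ := hS.isBounded.subset_closedBall (φ p)
  refine (hφ.isCompact_halfSqDist_le hR (r ^ 2 / 2)).of_isClosed_subset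
    (hS.isClosed.preimage hφ.contMDiff.continuous) fun x hx => ?_
  have h1 : ‖φ x - φ p‖ ≤ r := by
    rw [← dist_eq_norm]; exact hr hx
  have h2 : ‖φ x - φ p‖ ^ 2 ≤ r ^ 2 := by gcongr
  change ‖φ x - φ p‖ ^ 2 / 2 ≤ r ^ 2 / 2
  linarith

end ImmersedSubmanifold

/-! ### Sublevel sets of smooth functions as manifolds with boundary -/

namespace Sublevel

variable {m : ℕ} {M : Type*} [TopologicalSpace M] [ChartedSpace (EuclideanSpace ℝ (Fin m)) M]

/-- An open partial homeomorphism from `M` to `ℝᵐ` that is smooth in both directions. -/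
structure IsSmoothChart (e : OpenPartialHomeomorph M (EuclideanSpace ℝ (Fin m))) : Prop where
  contMDiffOn : ContMDiffOn (𝓡 m) (𝓡 m) ∞ e e.source
  contMDiffOn_symm : ContMDiffOn (𝓡 m) (𝓡 m) ∞ e.symm e.target

/-- A smooth map of the coordinates at `x` with invertible derivative gives new coordinates near
`x`. -/
theorem exists_isSmoothChart_comp [IsManifold (𝓡 m) ∞ M] (x : M)
    {G : EuclideanSpace ℝ (Fin m) → EuclideanSpace ℝ (Fin m)}
    (hG : ContDiffOn ℝ ∞ G (chartAt (EuclideanSpace ℝ (Fin m)) x).target)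
    {A : EuclideanSpace ℝ (Fin m) ≃L[ℝ] EuclideanSpace ℝ (Fin m)}
    (hA : HasFDerivAt G (A : EuclideanSpace ℝ (Fin m) →L[ℝ] EuclideanSpace ℝ (Fin m))
      (chartAt (EuclideanSpace ℝ (Fin m)) x x))
    {U : Set M} (hU : IsOpen U) (hx : x ∈ U) :
    ∃ e : OpenPartialHomeomorph M (EuclideanSpace ℝ (Fin m)), IsSmoothChart e ∧ x ∈ e.source ∧
      e.source ⊆ U ∩ (chartAt (EuclideanSpace ℝ (Fin m)) x).source ∧
      ∀ z, e z = G (chartAt (EuclideanSpace ℝ (Fin m)) x z) := by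
  set k := chartAt (EuclideanSpace ℝ (Fin m)) x with hk
  have hkx : k x ∈ k.target := mem_chart_target _ x
  have hGx : ContDiffAt ℝ ∞ G (k x) := hG.contDiffAt (k.open_target.mem_nhds hkx)
  set g := hGx.toOpenPartialHomeomorph G hA (by simp) with hg
  have hgc : (g : EuclideanSpace ℝ (Fin m) → EuclideanSpace ℝ (Fin m)) = G :=
    hGx.toOpenPartialHomeomorph_coe hA (by simp)
  -- the inverse of `g` is smooth where the derivative of `G` is invertible
  set S := k.target ∩ fderiv ℝ G ⁻¹' range ((↑) : (EuclideanSpace ℝ (Fin m) ≃L[ℝ]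
    EuclideanSpace ℝ (Fin m)) → EuclideanSpace ℝ (Fin m) →L[ℝ] EuclideanSpace ℝ (Fin m)) with hS
  have hSo : IsOpen S :=
    (hG.continuousOn_fderiv_of_isOpen k.open_target (by simp)).isOpen_inter_preimage
      k.open_target ContinuousLinearEquiv.isOpen
  refine ⟨(k.restrOpen U hU).trans (g.restrOpen S hSo), ⟨?_, ?_⟩, ?_, ?_, fun z => ?_⟩
  · intro z hz
    simp only [mfld_simps] at hz
    have h1 : ContMDiffAt (𝓡 m) (𝓡 m) ∞ k z :=
      contMDiffOn_chart.contMDiffAt (k.open_source.mem_nhds hz.1.1)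
    have h2 : ContDiffAt ℝ ∞ G (k z) := hG.contDiffAt (k.open_target.mem_nhds hz.2.2.1)
    refine (ContMDiffAt.comp z (g := G) h2.contMDiffAt h1).contMDiffWithinAt.congr
      (fun y _ => ?_) ?_
    · simp [hgc]
    · simp [hgc]
  · intro y hy
    simp only [mfld_simps] at hy
    obtain ⟨B, hB⟩ := hy.1.2.2
    have h2 : ContDiffAt ℝ ∞ G (g.symm y) := hG.contDiffAt (k.open_target.mem_nhds hy.1.2.1)
    have h1 : ContDiffAt ℝ ∞ g.symm y := by
      refine g.contDiffAt_symm (f₀' := B) hy.1.1 ?_ ?_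
      · rw [hgc, hB]
        exact (h2.differentiableAt (by simp)).hasFDerivAt
      · rwa [hgc]
    have h3 : ContMDiffAt (𝓡 m) (𝓡 m) ∞ k.symm (g.symm y) :=
      contMDiffOn_chart_symm.contMDiffAt (k.open_target.mem_nhds hy.1.2.1)
    exact (ContMDiffAt.comp y h3 h1.contMDiffAt).contMDiffWithinAt
  · simp only [mfld_simps]
    refine ⟨⟨mem_chart_source _ x, hx⟩, hGx.mem_toOpenPartialHomeomorph_source hA (by simp),
      hkx, A, ?_⟩
    exact hA.fderiv.symm
  · intro z hz
    simp only [mfld_simps] at hz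
    exact ⟨hz.1.2, hz.1.1⟩
  · simp [hgc]

variable [NeZero m]

/-- A smooth chart of `M` is adapted to `{f ≤ R}` if it maps this set to the half-space and its
interior to the open half-space. -/
structure IsAdaptedChart (f : M → ℝ) (R : ℝ)
    (e : OpenPartialHomeomorph M (EuclideanSpace ℝ (Fin m))) : Prop extends IsSmoothChart e where
  le_iff : ∀ z ∈ e.source, f z ≤ R ↔ 0 ≤ e z 0
  lt_iff : ∀ z ∈ e.source, f z < R ↔ 0 < e z 0

/-- Every nonzero functional on `ℝᵐ` is the first coordinate of a linear isomorphism. -/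
theorem exists_equiv_apply_zero_eq {l : EuclideanSpace ℝ (Fin m) →L[ℝ] ℝ} (hl : l ≠ 0) :
    ∃ A : EuclideanSpace ℝ (Fin m) ≃L[ℝ] EuclideanSpace ℝ (Fin m), ∀ y, A y 0 = l y := by
  set w := (InnerProductSpace.toDual ℝ (EuclideanSpace ℝ (Fin m))).symm l with hw
  have hw0 : w ≠ 0 := by simpa [hw] using hl
  have he0 : (EuclideanSpace.single 0 1 : EuclideanSpace ℝ (Fin m)) ≠ 0 := by
    intro h
    simpa using congrArg (fun v : EuclideanSpace ℝ (Fin m) => v 0) h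
  obtain ⟨B, hB⟩ := SeparatingDual.exists_continuousLinearEquiv_apply_eq (R := ℝ) he0 hw0
  -- if `l = ⟪w, ·⟫` and `B` maps the first basis vector to `w`, take the adjoint of `B`
  set L := ContinuousLinearMap.adjoint
    (B : EuclideanSpace ℝ (Fin m) →L[ℝ] EuclideanSpace ℝ (Fin m)) with hL
  have hinj : Function.Injective L.toLinearMap := by
    rw [injective_iff_map_eq_zero]
    intro y hy
    have h : inner ℝ (B (B.symm y)) y = 0 := by
      have := ContinuousLinearMap.adjoint_inner_right
        (B : EuclideanSpace ℝ (Fin m) →L[ℝ] EuclideanSpace ℝ (Fin m)) (B.symm y) y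
      rw [← hL, show L y = 0 from hy, inner_zero_right] at this
      exact this.symm
    simpa using h
  refine ⟨(LinearEquiv.ofInjectiveEndo L.toLinearMap hinj).toContinuousLinearEquiv, fun y => ?_⟩
  have h1 : L y 0 = inner ℝ (EuclideanSpace.single 0 1 : EuclideanSpace ℝ (Fin m)) (L y) := by
    simp [EuclideanSpace.inner_single_left]
  change L y 0 = l y
  rw [h1, hL, ContinuousLinearMap.adjoint_inner_right]
  change inner ℝ (B (EuclideanSpace.single 0 1)) y = l y
  rw [hB, hw, InnerProductSpace.toDual_symm_apply]

/-- Around a point of `{f < R}`, translate a chart so that the image of the point lies in the open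
half-space, and shrink its domain. -/
theorem exists_isAdaptedChart_of_lt [IsManifold (𝓡 m) ∞ M] {f : M → ℝ} (hf : Continuous f) {R : ℝ}
    {x : M} (hx : f x < R) : ∃ e, IsAdaptedChart (m := m) f R e ∧ x ∈ e.source := by
  set k := chartAt (EuclideanSpace ℝ (Fin m)) x with hk
  set G : EuclideanSpace ℝ (Fin m) → EuclideanSpace ℝ (Fin m) :=
    fun y => y + (EuclideanSpace.single 0 1 - k x) with hG
  have hGs : ContDiff ℝ ∞ G := contDiff_id.add contDiff_const
  have hGx : 0 < G (k x) 0 := by simp [hG]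
  have hpos : IsOpen {y | 0 < G y 0} := by
    refine isOpen_lt continuous_const ?_
    exact (EuclideanSpace.proj (𝕜 := ℝ) (0 : Fin m)).continuous.comp hGs.continuous
  obtain ⟨e, he, hxe, hsub, heq⟩ := exists_isSmoothChart_comp x hGs.contDiffOn
    (A := ContinuousLinearEquiv.refl ℝ _) ((hasFDerivAt_id _).add_const _)
    ((isOpen_lt hf continuous_const).inter (k.isOpen_inter_preimage hpos))
    ⟨hx, mem_chart_source _ x, hGx⟩
  refine ⟨e, ⟨he, fun z hz => ?_, fun z hz => ?_⟩, hxe⟩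
  · rw [heq]
    exact iff_of_true (hsub hz).1.1.le (hsub hz).1.2.2.le
  · rw [heq]
    exact iff_of_true (hsub hz).1.1 (hsub hz).1.2.2

/-- Around a regular point of the level `R`, the function `R - f` is the first coordinate of a
chart. -/
theorem exists_isAdaptedChart_of_regular [IsManifold (𝓡 m) ∞ M] {f : M → ℝ}
    (hf : ContMDiff (𝓡 m) 𝓘(ℝ, ℝ) ∞ f) {R : ℝ} {x : M}
    (hdf : mfderiv (𝓡 m) 𝓘(ℝ, ℝ) f x ≠ 0) :
    ∃ e, IsAdaptedChart (m := m) f R e ∧ x ∈ e.source := by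
  set k := chartAt (EuclideanSpace ℝ (Fin m)) x with hk
  set F : EuclideanSpace ℝ (Fin m) → ℝ := f ∘ k.symm with hF
  have hFs : ContDiffOn ℝ ∞ F k.target := by
    rw [← contMDiffOn_iff_contDiffOn]
    exact hf.comp_contMDiffOn contMDiffOn_chart_symm
  have hkx : k x ∈ k.target := mem_chart_target _ x
  have hFd : HasFDerivAt F (fderiv ℝ F (k x)) (k x) :=
    ((hFs.contDiffAt (k.open_target.mem_nhds hkx)).differentiableAt (by simp)).hasFDerivAt
  have hne : -fderiv ℝ F (k x) ≠ 0 := by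
    rw [neg_ne_zero]
    intro h0
    refine hdf ?_
    rw [ImmersedSubmanifold.mfderiv_eq_fderiv_chart ((hf x).mdifferentiableAt (by simp))]
    exact h0
  obtain ⟨A, hA⟩ := exists_equiv_apply_zero_eq hne
  set pr : EuclideanSpace ℝ (Fin m) →L[ℝ] ℝ := EuclideanSpace.proj 0 with hpr
  -- replace the first coordinate of `A y` by `R - F y`; this does not change the derivative at `k x`
  set G : EuclideanSpace ℝ (Fin m) → EuclideanSpace ℝ (Fin m) := fun y =>
    A y + (R - F y - pr (A y)) • EuclideanSpace.single 0 1 with hG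
  have hG0 (y : EuclideanSpace ℝ (Fin m)) : G y 0 = R - F y := by simp [hG, hpr]
  have hGs : ContDiffOn ℝ ∞ G k.target := by
    refine A.contDiff.contDiffOn.add ((((contDiffOn_const (c := R)).sub hFs).sub
      (pr.contDiff.comp A.contDiff).contDiffOn).smul contDiffOn_const)
  have hAd : HasFDerivAt (fun y => A y)
      (A : EuclideanSpace ℝ (Fin m) →L[ℝ] EuclideanSpace ℝ (Fin m)) (k x) := A.hasFDerivAt
  have hGd : HasFDerivAt G (A : EuclideanSpace ℝ (Fin m) →L[ℝ] EuclideanSpace ℝ (Fin m)) (k x) := by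
    have h := hAd.add ((((hasFDerivAt_const R (k x)).sub hFd).sub
      (pr.hasFDerivAt.comp (k x) hAd)).smul_const (EuclideanSpace.single 0 1))
    refine h.congr_fderiv ?_
    ext1 v
    have : pr (A v) = -fderiv ℝ F (k x) v := hA v
    simp [this]
  obtain ⟨e, he, hxe, hsub, heq⟩ := exists_isSmoothChart_comp x hGs hGd isOpen_univ (mem_univ x)
  have h0 (z : M) (hz : z ∈ e.source) : e z 0 = R - f z := by
    rw [heq, hG0, hF, Function.comp_apply, k.left_inv (hsub hz).2]
  refine ⟨e, ⟨he, fun z hz => ?_, fun z hz => ?_⟩, hxe⟩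
  · rw [h0 z hz, sub_nonneg]
  · rw [h0 z hz, sub_pos]

end Sublevel

namespace Sublevel

variable {m : ℕ} [NeZero m] {M : Type*} [TopologicalSpace M]
  [ChartedSpace (EuclideanSpace ℝ (Fin m)) M] {f : M → ℝ} {R : ℝ}

/-- The chart of the subspace `{f ≤ R}` induced by an adapted chart of `M`. The points outside
the source and the target get junk values. -/
def halfSpaceChart {e : OpenPartialHomeomorph M (EuclideanSpace ℝ (Fin m))}
    (he : IsAdaptedChart f R e) (x₀ : {x // f x ≤ R}) :
    OpenPartialHomeomorph {x // f x ≤ R} (EuclideanHalfSpace m) where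
  toFun z := (𝓡∂ m).symm (e z)
  invFun y := open Classical in if h : f (e.symm y.1) ≤ R then ⟨e.symm y.1, h⟩ else x₀
  source := {z | z.1 ∈ e.source}
  target := {y | y.1 ∈ e.target}
  map_source' z hz := by
    have h1 : (𝓡∂ m) ((𝓡∂ m).symm (e z)) = e z := (𝓡∂ m).right_inv (by
      rw [range_modelWithCornersEuclideanHalfSpace]
      exact (he.le_iff z hz).1 z.2)
    change (𝓡∂ m) ((𝓡∂ m).symm (e z)) ∈ e.target
    rw [h1]
    exact e.map_source hz
  map_target' y hy := by
    have h : f (e.symm y.1) ≤ R := by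
      rw [he.le_iff _ (e.map_target hy), e.right_inv hy]
      exact y.2
    simp only [h, dite_true]
    exact e.map_target hy
  left_inv' z hz := by
    have h1 : (𝓡∂ m) ((𝓡∂ m).symm (e z)) = e z := (𝓡∂ m).right_inv (by
      rw [range_modelWithCornersEuclideanHalfSpace]
      exact (he.le_iff z hz).1 z.2)
    have h2 : e.symm ((𝓡∂ m).symm (e z)).1 = z.1 := by
      change e.symm ((𝓡∂ m) ((𝓡∂ m).symm (e z))) = z.1
      rw [h1, e.left_inv hz]
    have h3 : f (e.symm ((𝓡∂ m).symm (e z)).1) ≤ R := by rw [h2]; exact z.2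
    simp only [h3, dite_true]
    exact Subtype.ext h2
  right_inv' y hy := by
    have h : f (e.symm y.1) ≤ R := by
      rw [he.le_iff _ (e.map_target hy), e.right_inv hy]
      exact y.2
    simp only [h, dite_true]
    rw [e.right_inv hy]
    exact (𝓡∂ m).left_inv y
  open_source := e.open_source.preimage continuous_subtype_val
  open_target := e.open_target.preimage continuous_subtype_val
  continuousOn_toFun := (𝓡∂ m).continuous_symm.comp_continuousOn
    (e.continuousOn.comp continuous_subtype_val.continuousOn fun _ hz => hz)
  continuousOn_invFun := by
    rw [(Topology.IsEmbedding.subtypeVal (p := fun x => f x ≤ R)).isInducing.continuousOn_iff]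
    refine (e.continuousOn_symm.comp continuous_subtype_val.continuousOn fun _ hy => hy).congr
      fun y hy => ?_
    have h : f (e.symm y.1) ≤ R := by
      rw [he.le_iff _ (e.map_target hy), e.right_inv hy]
      exact y.2
    simp only [h, dite_true, Function.comp_apply]

theorem coe_halfSpaceChart {e : OpenPartialHomeomorph M (EuclideanSpace ℝ (Fin m))}
    (he : IsAdaptedChart f R e) (x₀ : {x // f x ≤ R}) {z : {x // f x ≤ R}} (hz : z.1 ∈ e.source) :
    (halfSpaceChart he x₀ z).1 = e z :=
  (𝓡∂ m).right_inv (by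
    rw [range_modelWithCornersEuclideanHalfSpace]
    exact (he.le_iff z hz).1 z.2)

theorem coe_halfSpaceChart_symm {e : OpenPartialHomeomorph M (EuclideanSpace ℝ (Fin m))}
    (he : IsAdaptedChart f R e) (x₀ : {x // f x ≤ R}) {y : EuclideanHalfSpace m}
    (hy : y.1 ∈ e.target) : ((halfSpaceChart he x₀).symm y).1 = e.symm y.1 := by
  have h : f (e.symm y.1) ≤ R := by
    rw [he.le_iff _ (e.map_target hy), e.right_inv hy]
    exact y.2
  change (dite _ _ _ : {x // f x ≤ R}).1 = _
  rw [dif_pos h]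

variable (h : ∀ x, f x ≤ R → ∃ e, IsAdaptedChart (m := m) f R e ∧ x ∈ e.source)

/-- The structure of a manifold with boundary on `{f ≤ R}` given by adapted charts. -/
@[reducible] def chartedSpace : ChartedSpace (EuclideanHalfSpace m) {x // f x ≤ R} where
  atlas := range fun x : {x // f x ≤ R} => halfSpaceChart (h x.1 x.2).choose_spec.1 x
  chartAt x := halfSpaceChart (h x.1 x.2).choose_spec.1 x
  mem_chart_source x := (h x.1 x.2).choose_spec.2
  chart_mem_atlas x := mem_range_self x

theorem isManifold : letI := chartedSpace h; IsManifold (𝓡∂ m) ∞ {x // f x ≤ R} := by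
  let := chartedSpace h
  refine isManifold_of_contDiffOn _ _ _ ?_
  rintro _ _ ⟨x, rfl⟩ ⟨x', rfl⟩
  set he := (h x.1 x.2).choose_spec.1
  set he' := (h x'.1 x'.2).choose_spec.1
  set e := (h x.1 x.2).choose
  set e' := (h x'.1 x'.2).choose
  have hc : ContDiffOn ℝ ∞ (e' ∘ e.symm) (e.target ∩ e.symm ⁻¹' e'.source) := by
    rw [← contMDiffOn_iff_contDiffOn]
    exact he'.contMDiffOn.comp (he.contMDiffOn_symm.mono inter_subset_left) fun y hy => hy.2
  have key : ∀ y ∈ (𝓡∂ m).symm ⁻¹' ((halfSpaceChart he x).symm ≫ₕ halfSpaceChart he' x').source ∩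
      range (𝓡∂ m), y ∈ e.target ∩ e.symm ⁻¹' e'.source ∧
      (𝓡∂ m) (((halfSpaceChart he x).symm ≫ₕ halfSpaceChart he' x') ((𝓡∂ m).symm y)) =
        (e' ∘ e.symm) y := by
    rintro _ ⟨hy, y, rfl⟩
    rw [mem_preimage, (𝓡∂ m).left_inv] at hy
    rw [(𝓡∂ m).left_inv]
    have h1 : y.1 ∈ e.target := hy.1
    have h2 : ((halfSpaceChart he x).symm y).1 ∈ e'.source := hy.2
    have h3 := coe_halfSpaceChart he' x' h2
    rw [coe_halfSpaceChart_symm he x h1] at h2 h3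
    exact ⟨⟨h1, h2⟩, h3⟩
  exact (hc.mono fun y hy => (key y hy).1).congr fun y hy => (key y hy).2

theorem extChartAt_eq (x : {x // f x ≤ R}) : letI := chartedSpace h
    ∀ z : {x // f x ≤ R}, z.1 ∈ (h x.1 x.2).choose.source →
      extChartAt (𝓡∂ m) x z = (h x.1 x.2).choose z :=
  fun _ hz => coe_halfSpaceChart (h x.1 x.2).choose_spec.1 x hz

theorem mem_interior_iff (x : {x // f x ≤ R}) : letI := chartedSpace h
    x ∈ (𝓡∂ m).interior {x // f x ≤ R} ↔ f x < R := by
  let := chartedSpace h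
  have hx := (h x.1 x.2).choose_spec.2
  change extChartAt (𝓡∂ m) x x ∈ interior (range (𝓡∂ m)) ↔ _
  rw [extChartAt_eq h x x hx, interior_range_modelWithCornersEuclideanHalfSpace,
    (h x.1 x.2).choose_spec.1.lt_iff x hx]
  rfl

theorem contMDiff_val : letI := chartedSpace h
    ContMDiff (𝓡∂ m) (𝓡 m) ∞ (Subtype.val : {x // f x ≤ R} → M) := by
  let := chartedSpace h
  have : IsManifold (𝓡∂ m) ∞ {x // f x ≤ R} := isManifold h
  intro x
  have hx := (h x.1 x.2).choose_spec.2
  set he := (h x.1 x.2).choose_spec.1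
  set e := (h x.1 x.2).choose
  have h1 : ContMDiffAt (𝓡∂ m) (𝓡 m) ∞ (extChartAt (𝓡∂ m) x) x := contMDiffAt_extChartAt
  have h2 : ContMDiffAt (𝓡 m) (𝓡 m) ∞ e.symm (extChartAt (𝓡∂ m) x x) := by
    rw [extChartAt_eq h x x hx]
    exact he.contMDiffOn_symm.contMDiffAt (e.open_target.mem_nhds (e.map_source hx))
  refine (ContMDiffAt.comp x h2 h1).congr_of_eventuallyEq ?_
  filter_upwards [(e.open_source.preimage continuous_subtype_val).mem_nhds hx] with z hz
  rw [Function.comp_apply, extChartAt_eq h x z hz, e.left_inv hz]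

/-- A map into the interior of the manifold `{f ≤ R}` is smooth if it is smooth as a map
into `M`. -/
theorem contMDiff_interior {E' H' P : Type*} [NormedAddCommGroup E'] [NormedSpace ℝ E']
    [TopologicalSpace H'] {J : ModelWithCorners ℝ E' H'} [TopologicalSpace P] [ChartedSpace H' P]
    (U : TopologicalSpace.Opens {x // f x ≤ R}) {g : P → U}
    (hg : ContMDiff J (𝓡 m) ∞ fun y => (g y).1.1) : letI := chartedSpace h
    ContMDiff J (𝓡∂ m) ∞ g := by
  let := chartedSpace h
  intro y
  rw [contMDiffAt_iff_target]
  refine ⟨((hg.continuous.subtype_mk _).subtype_mk _).continuousAt, ?_⟩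
  · have hx := (h (g y).1.1 (g y).1.2).choose_spec.2
    set he := (h (g y).1.1 (g y).1.2).choose_spec.1
    set e := (h (g y).1.1 (g y).1.2).choose
    have h1 : ContMDiffAt (𝓡 m) (𝓡 m) ∞ e (g y).1.1 :=
      he.contMDiffOn.contMDiffAt (e.open_source.mem_nhds hx)
    refine (ContMDiffAt.comp y h1 (hg y)).congr_of_eventuallyEq ?_
    filter_upwards [hg.continuous.continuousAt.preimage_mem_nhds (e.open_source.mem_nhds hx)]
      with z hz
    exact extChartAt_eq h (g y).1 (g z).1 hz

end Sublevel

/-! ### Pushing a manifold into a sublevel set along a flow -/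

/-- There is a diffeomorphism `r ↦ r + k r` from `(-∞, a + 1)` to `ℝ` with `k ≥ 0` vanishing on
`(-∞, a]`; its inverse is `h`. -/
theorem exists_stretching (a : ℝ) : ∃ k h : ℝ → ℝ, ContDiffOn ℝ ∞ k (Iio (a + 1)) ∧
    ContDiff ℝ ∞ h ∧ (∀ r < a + 1, 0 ≤ k r) ∧ (∀ r ≤ a, k r = 0) ∧ (∀ s, h s < a + 1) ∧
    (∀ s, h s + k (h s) = s) ∧ ∀ r < a + 1, h (r + k r) = r := by
  set k : ℝ → ℝ := fun r => expNegInvGlue (r - a) / (a + 1 - r) with hk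
  have hks : ContDiffOn ℝ ∞ k (Iio (a + 1)) := by
    refine (expNegInvGlue.contDiff.comp (contDiff_id.sub contDiff_const)).contDiffOn.div
      (contDiff_const.sub contDiff_id).contDiffOn fun r hr => ?_
    exact (sub_pos.2 hr).ne'
  have hk0 (r : ℝ) (hr : r < a + 1) : 0 ≤ k r :=
    div_nonneg (expNegInvGlue.nonneg _) (sub_pos.2 hr).le
  have hka (r : ℝ) (hr : r ≤ a) : k r = 0 := by
    simp [hk, expNegInvGlue.zero_of_nonpos (sub_nonpos.2 hr)]
  have hkm : MonotoneOn k (Iio (a + 1)) := fun r hr s hs hrs =>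
    div_le_div₀ (expNegInvGlue.nonneg _) (expNegInvGlue.monotone (by linarith))
      (sub_pos.2 hs) (by linarith)
  set H : ℝ → ℝ := fun r => r + k r with hH
  have hHs : ContDiffOn ℝ ∞ H (Iio (a + 1)) := contDiffOn_id.add hks
  have hHm : StrictMonoOn H (Iio (a + 1)) := fun r hr s hs hrs =>
    add_lt_add_of_lt_of_le hrs (hkm hr hs hrs.le)
  have hsurj (s : ℝ) : ∃ r < a + 1, H r = s := by
    rcases le_or_gt s a with hs | hs
    · exact ⟨s, by linarith, by simp [hH, hka s hs]⟩
    · set q := expNegInvGlue (1 / 2) with hq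
      have hq0 : 0 < q := expNegInvGlue.pos_of_pos (by norm_num)
      have hsa : 0 < s - a := sub_pos.2 hs
      set d := min (1 / 2) (q / (s - a)) with hd
      have hd0 : 0 < d := by positivity
      have hdh : d ≤ 1 / 2 := min_le_left _ _
      have hdq : d * (s - a) ≤ q := (le_div_iff₀ hsa).1 (min_le_right _ _)
      have h1 : s ≤ H (a + 1 - d) := by
        have h2 : q ≤ expNegInvGlue (a + 1 - d - a) := expNegInvGlue.monotone (by linarith)
        have h3 : s - a ≤ k (a + 1 - d) := by
          change _ ≤ _ / (a + 1 - (a + 1 - d))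
          rw [le_div_iff₀ (by linarith)]
          linarith
        change s ≤ a + 1 - d + k (a + 1 - d)
        linarith
      obtain ⟨r, hr, hrs⟩ := intermediate_value_Icc (a := a) (b := a + 1 - d) (by linarith)
        (hHs.continuousOn.mono fun r hr => by have := hr.2; simp only [mem_Iio]; linarith)
        (⟨by simp [hH, hka a le_rfl, hs.le], h1⟩ : s ∈ Icc _ _)
      exact ⟨r, by linarith [hr.2], hrs⟩
  choose h hlt hh using hsurj
  have hinv (r : ℝ) (hr : r < a + 1) : h (H r) = r := hHm.injOn (hlt _) hr (hh _)
  refine ⟨k, h, hks, contDiff_iff_contDiffAt.2 fun s => ?_, hk0, hka, hlt, hh, hinv⟩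
  have hn : Iio (a + 1) ∈ 𝓝 (h s) := isOpen_Iio.mem_nhds (hlt s)
  have hkd := ((hks.contDiffAt hn).differentiableAt (by simp)).hasDerivAt
  -- `k` is increasing, so the derivative of `H` is at least `1`
  have hd : 1 + deriv k (h s) ≠ 0 := by
    have : 0 ≤ deriv k (h s) := by
      rw [← derivWithin_of_mem_nhds hn]
      exact hkm.derivWithin_nonneg
    linarith
  have hHd : ContDiffAt ℝ ∞ H (h s) := hHs.contDiffAt hn
  have hHe := ((hasDerivAt_id (h s)).add hkd).hasFDerivAt_equiv hd
  set g := hHd.toOpenPartialHomeomorph H hHe (by simp) with hg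
  have hgc : (g : ℝ → ℝ) = H := hHd.toOpenPartialHomeomorph_coe hHe (by simp)
  have hgm : h s ∈ g.source := hHd.mem_toOpenPartialHomeomorph_source hHe (by simp)
  have hgs : g (h s) = s := by rw [hgc, hH]; exact hh s
  have hst : s ∈ g.target := hgs ▸ g.map_source hgm
  have hsymm : g.symm s = h s := by rw [← g.left_inv hgm, hgs]
  have hsm : ContDiffAt ℝ ∞ g.symm s := by
    refine g.contDiffAt_symm_deriv hd hst ?_ (by rw [hgc, hsymm]; exact hHd)
    rw [hgc, hsymm]
    exact (hasDerivAt_id (h s)).add hkd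
  refine hsm.congr_of_eventuallyEq ?_
  filter_upwards [g.open_target.mem_nhds hst,
    hsm.continuousAt.preimage_mem_nhds (hsymm ▸ hn)] with t ht htn
  have h2 : H (g.symm t) = t := by rw [← hgc]; exact g.right_inv ht
  rw [← hinv _ htn, h2]

namespace Sublevel

section LevelFlow

variable {M : Type*} {f : M → ℝ} {Φ : M × ℝ → M} {χ : ℝ → ℝ} {a : ℝ}

/-- If `f` solves `u' = χ u` along the trajectories of `Φ`, and `χ = 1` above `a`, then `f` grows
at unit speed from each point with `f ≥ a`. -/
theorem apply_flow_eq_add (h0 : ∀ x, Φ (x, 0) = x)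
    (hf : ∀ x t, HasDerivAt (fun t => f (Φ (x, t))) (χ (f (Φ (x, t)))) t) (hχ0 : ∀ r, 0 ≤ χ r)
    (hχ : ∀ r, a ≤ r → χ r = 1) {x : M} (hx : a ≤ f x) {t : ℝ} (ht : 0 ≤ t) :
    f (Φ (x, t)) = f x + t := by
  rcases ht.eq_or_lt with rfl | ht
  · simp [h0]
  have hmono : Monotone fun t => f (Φ (x, t)) :=
    monotone_of_deriv_nonneg (fun t => (hf x t).differentiableAt)
      fun t => by rw [(hf x t).deriv]; exact hχ0 _
  obtain ⟨c, hc, hslope⟩ := exists_hasDerivAt_eq_slope _ _ ht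
    (fun t _ => (hf x t).continuousAt.continuousWithinAt) fun t _ => hf x t
  have hac : a ≤ f (Φ (x, c)) := hx.trans (by simpa [h0] using hmono hc.1.le)
  rw [hχ _ hac, h0, sub_zero, eq_div_iff ht.ne'] at hslope
  linarith

/-- Backward in time, `f` decreases at unit speed as long as it stays above `a`. -/
theorem apply_flow_neg_eq_sub (h0 : ∀ x, Φ (x, 0) = x)
    (hadd : ∀ x s t, Φ (Φ (x, s), t) = Φ (x, t + s))
    (hf : ∀ x t, HasDerivAt (fun t => f (Φ (x, t))) (χ (f (Φ (x, t)))) t) (hχ0 : ∀ r, 0 ≤ χ r)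
    (hχ1 : ∀ r, χ r ≤ 1) (hχ : ∀ r, a ≤ r → χ r = 1) {x : M} {t : ℝ} (ht : 0 ≤ t)
    (hx : a + t ≤ f x) : f (Φ (x, -t)) = f x - t := by
  have hback : Φ (Φ (x, -t), t) = x := by rw [hadd, add_neg_cancel, h0]
  rcases le_or_gt a (f (Φ (x, -t))) with hy | hy
  · have := apply_flow_eq_add h0 hf hχ0 hχ hy ht
    rw [hback] at this
    linarith
  · rcases ht.eq_or_lt with rfl | ht
    · simp [h0]
    -- the speed is at most `1`, so that `f` cannot climb from below `a` to `a + t` in time `t`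
    obtain ⟨c, hc, hslope⟩ := exists_hasDerivAt_eq_slope _ _ ht
      (fun r _ => (hf (Φ (x, -t)) r).continuousAt.continuousWithinAt) fun r _ => hf (Φ (x, -t)) r
    have h1 := hχ1 (f (Φ (Φ (x, -t), c)))
    rw [hslope, hback, h0, sub_zero, div_le_one ht] at h1
    linarith

end LevelFlow

universe u

variable {m : ℕ} [NeZero m] {M : Type u} [TopologicalSpace M] [T2Space M]
  [ChartedSpace (EuclideanSpace ℝ (Fin m)) M] [IsManifold (𝓡 m) ∞ M]

/-- If a smooth flow raises `f` at unit speed above the level `a`, then `M` is diffeomorphic to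
`{f < a + 1}`: the part above `a` is compressed along the trajectories. -/
theorem isInteriorOfCompact_of_flow {f : M → ℝ} (hfs : ContMDiff (𝓡 m) 𝓘(ℝ, ℝ) ∞ f)
    {Φ : M × ℝ → M} (hΦ : ContMDiff ((𝓡 m).prod 𝓘(ℝ, ℝ)) (𝓡 m) ∞ Φ) (h0 : ∀ x, Φ (x, 0) = x)
    (hadd : ∀ x s t, Φ (Φ (x, s), t) = Φ (x, t + s)) {χ : ℝ → ℝ} {a : ℝ}
    (hf : ∀ x t, HasDerivAt (fun t => f (Φ (x, t))) (χ (f (Φ (x, t)))) t) (hχ0 : ∀ r, 0 ≤ χ r)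
    (hχ1 : ∀ r, χ r ≤ 1) (hχ : ∀ r, a ≤ r → χ r = 1) (hcomp : IsCompact {x | f x ≤ a + 1}) :
    ImmersedSubmanifold.IsInteriorOfCompact m M := by
  have hcharts (x : M) (hx : f x ≤ a + 1) :
      ∃ e, IsAdaptedChart (m := m) f (a + 1) e ∧ x ∈ e.source := by
    rcases hx.lt_or_eq with hx | hx
    · exact exists_isAdaptedChart_of_lt hfs.continuous hx
    · refine exists_isAdaptedChart_of_regular hfs fun hd => ?_
      -- the derivative of `f` along the flow is `1`, hence `df ≠ 0`
      have hcurve : MDifferentiableAt 𝓘(ℝ, ℝ) (𝓡 m) (fun t => Φ (x, t)) 0 := by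
        have h1 : ContMDiff 𝓘(ℝ, ℝ) ((𝓡 m).prod 𝓘(ℝ, ℝ)) ∞ (fun t : ℝ => (x, t)) :=
          contMDiff_const.prodMk contMDiff_id
        exact ((hΦ.comp h1) 0).mdifferentiableAt (by simp)
      have hfd : HasMFDerivAt (𝓡 m) 𝓘(ℝ, ℝ) f (Φ (x, 0)) 0 := by
        rw [h0]
        have := ((hfs x).mdifferentiableAt (by simp)).hasMFDerivAt
        rwa [hd] at this
      have h2 := (hfd.comp (0 : ℝ) hcurve.hasMFDerivAt).hasFDerivAt
      have h3 : HasFDerivAt (𝕜 := ℝ) (fun t => f (Φ (x, t))) (0 : ℝ →L[ℝ] ℝ) 0 := by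
        refine HasFDerivAt.congr_fderiv h2 ?_
        exact ContinuousLinearMap.zero_comp _
      have h4 := (hf x 0).unique h3.hasDerivAt
      rw [h0, hχ _ (by linarith)] at h4
      simp at h4
  obtain ⟨k, h, hks, hhs, hk0, hka, hlt, hh, hinv⟩ := exists_stretching a
  let := chartedSpace hcharts
  have hman : IsManifold (𝓡∂ m) ∞ {x // f x ≤ a + 1} := isManifold hcharts
  have hcs : CompactSpace {x // f x ≤ a + 1} := isCompact_iff_compactSpace.1 hcomp
  refine ⟨{x // f x ≤ a + 1}, inferInstance, inferInstance, hman, hcs, inferInstance, ⟨?_⟩⟩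
  have hle (s : ℝ) (hs : s ≤ a) : h s = s := by
    have := hinv s (by linarith)
    rwa [hka s hs, add_zero] at this
  have hge (s : ℝ) (hs : a ≤ s) : a ≤ h s := by
    by_contra! hlt'
    have := hh s
    rw [hka _ hlt'.le] at this
    linarith
  -- `Ψ` flows from level `s` down to level `h s`, and `Ξ` from level `r` up to level `r + k r`
  set Ψ : M → M := fun y => Φ (y, -k (h (f y))) with hΨ
  set Ξ : M → M := fun x => Φ (x, k (f x)) with hΞ
  have hfΨ (y : M) : f (Ψ y) = h (f y) := by
    rcases le_total (f y) a with hy | hy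
    · simp only [hΨ, hle _ hy, hka _ hy, neg_zero, h0]
    · have h1 := hh (f y)
      have h2 := hge _ hy
      have := apply_flow_neg_eq_sub h0 hadd hf hχ0 hχ1 hχ (hk0 _ (hlt (f y))) (x := y)
        (by linarith)
      simp only [hΨ, this]
      linarith
  have hfΞ (x : M) (hx : f x < a + 1) : f (Ξ x) = f x + k (f x) := by
    rcases le_total (f x) a with hxa | hxa
    · simp only [hΞ, hka _ hxa, h0, add_zero]
    · exact apply_flow_eq_add h0 hf hχ0 hχ hxa (hk0 _ hx)
  have hΨs : ContMDiff (𝓡 m) (𝓡 m) ∞ Ψ := by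
    have h1 : ContDiff ℝ ∞ fun s => -k (h s) :=
      (contDiffOn_univ.1 (hks.comp hhs.contDiffOn fun s _ => hlt s)).neg
    exact hΦ.comp (contMDiff_id.prodMk (h1.contMDiff.comp hfs))
  have hΞs : ContMDiffOn (𝓡 m) (𝓡 m) ∞ Ξ {x | f x < a + 1} :=
    hΦ.comp_contMDiffOn (contMDiffOn_id.prodMk
      (hks.contMDiffOn.comp hfs.contMDiffOn fun x hx => hx))
  have hmem (y : M) : f (Ψ y) < a + 1 := by
    rw [hfΨ]
    exact hlt _
  refine ⟨⟨fun y => ⟨⟨Ψ y, (hmem y).le⟩, (mem_interior_iff hcharts _).2 (hmem y)⟩,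
    fun w => Ξ w.1.1, fun y => ?_, fun w => ?_⟩, ?_, ?_⟩
  · change Φ (Ψ y, k (f (Ψ y))) = y
    rw [hfΨ, hadd, add_neg_cancel, h0]
  · have hw : f w.1.1 < a + 1 := (mem_interior_iff hcharts w.1).1 w.2
    refine Subtype.ext (Subtype.ext ?_)
    change Φ (Ξ w.1.1, -k (h (f (Ξ w.1.1)))) = w.1.1
    rw [hfΞ _ hw, hinv _ hw, hadd, neg_add_cancel, h0]
  · exact contMDiff_interior hcharts _ hΨs
  · have h1 : ContMDiff (𝓡∂ m) (𝓡 m) ∞ (fun w : ((⟨(𝓡∂ m).interior {x // f x ≤ a + 1},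
        (𝓡∂ m).isOpen_interior (n := ∞) (by simp)⟩ :
          TopologicalSpace.Opens {x // f x ≤ a + 1})) => w.1.1) :=
      (contMDiff_val hcharts).comp contMDiff_subtype_val
    exact contMDiffOn_univ.1 (hΞs.comp h1.contMDiffOn fun w _ =>
      (mem_interior_iff hcharts w.1).1 w.2)

end Sublevel

/-! ### The normalized gradient flow of the distance function -/

namespace ImmersedSubmanifold

open SmoothFlow RiemannianGeometry

variable {m n : ℕ} {M : Type*} [MetricSpace M] [ChartedSpace (EuclideanSpace ℝ (Fin m)) M]
  [IsManifold (𝓡 m) ∞ M]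
  [Bundle.RiemannianBundle (fun x : M => TangentSpace (𝓡 m) x)]
  {φ : M → EuclideanSpace ℝ (Fin n)}

variable (m φ) in
/-- The factor that turns the gradient of `halfSqDist φ c` into a field along which this function
grows at unit speed above the level `a`; it vanishes below the level `a - 1`. -/
def ascentFactor (c : EuclideanSpace ℝ (Fin n)) (a : ℝ) (x : M) : ℝ :=
  Real.smoothTransition (halfSqDist φ c x - (a - 1)) / ‖tangentialPart m φ c x‖ ^ 2

namespace IsIsometricImmersion

variable (hφ : IsIsometricImmersion (m := m) φ) {c : EuclideanSpace ℝ (Fin n)} {a : ℝ}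
  (hT : ∀ x, a - 1 ≤ halfSqDist φ c x → 1 ≤ ‖tangentialPart m φ c x‖)

omit [IsManifold (𝓡 m) ∞ M] in
include hT in
theorem ascentFactor_mul_norm_sq (x : M) : ascentFactor m φ c a x * ‖tangentialPart m φ c x‖ ^ 2 =
    Real.smoothTransition (halfSqDist φ c x - (a - 1)) := by
  rcases le_total (a - 1) (halfSqDist φ c x) with hx | hx
  · have : 0 < ‖tangentialPart m φ c x‖ := one_pos.trans_le (hT x hx)
    unfold ascentFactor
    field_simp
  · simp [ascentFactor, Real.smoothTransition.zero_of_nonpos (sub_nonpos.2 hx)]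

include hφ hT

theorem contMDiff_ascentFactor : ContMDiff (𝓡 m) 𝓘(ℝ, ℝ) ∞ (ascentFactor m φ c a) := by
  intro x
  have hf := hφ.contMDiff_halfSqDist c
  rcases le_or_gt (a - 1) (halfSqDist φ c x) with hx | hx
  · have hne : ‖tangentialPart m φ c x‖ ^ 2 ≠ 0 := by
      have : 0 < ‖tangentialPart m φ c x‖ := one_pos.trans_le (hT x hx)
      positivity
    have h1 : ContMDiffAt (𝓡 m) 𝓘(ℝ, ℝ) ∞
        (fun x => Real.smoothTransition (halfSqDist φ c x - (a - 1))) x :=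
      ContMDiffAt.comp x (Real.smoothTransition.contDiff.comp
        (contDiff_id.sub contDiff_const)).contMDiff.contMDiffAt (hf x)
    have h2 : ContMDiffAt (𝓡 m) 𝓘(ℝ, ℝ) ∞ (fun x => (‖tangentialPart m φ c x‖ ^ 2)) x :=
      ContMDiffAt.comp x (contDiff_id.norm_sq ℝ).contMDiff.contMDiffAt
        (hφ.contMDiff_tangentialPart c x)
    exact h1.div₀ h2 hne
  · refine (contMDiffAt_const (c := (0 : ℝ))).congr_of_eventuallyEq ?_
    filter_upwards [(isOpen_lt hf.continuous continuous_const).mem_nhds hx] with y hy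
    have hy' : halfSqDist φ c y < a - 1 := hy
    simp [ascentFactor, Real.smoothTransition.zero_of_nonpos (sub_nonpos.2 hy'.le)]

omit [IsManifold (𝓡 m) ∞ M] in
theorem norm_ascentFactor_smul_le (x : M) :
    ‖ascentFactor m φ c a x • gradField (m := m) φ c x‖ ≤ 1 := by
  have h0 : 0 ≤ ascentFactor m φ c a x :=
    div_nonneg (Real.smoothTransition.nonneg _) (sq_nonneg _)
  rw [norm_smul, ← hφ.norm_tangentialPart, Real.norm_of_nonneg h0]
  rcases le_total (a - 1) (halfSqDist φ c x) with hx | hx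
  · have h1 := hT x hx
    have h2 := (ascentFactor_mul_norm_sq hT x).trans_le (Real.smoothTransition.le_one _)
    nlinarith [mul_nonneg h0 (sub_nonneg.2 h1)]
  · simp [ascentFactor, Real.smoothTransition.zero_of_nonpos (sub_nonpos.2 hx)]

/-- If the gradient has norm at least `1` above the level `a - 1`, the flow of its cut-off
normalization shows that `M` is diffeomorphic to the interior of `{halfSqDist φ c ≤ a + 1}`. -/
theorem isInteriorOfCompact [NeZero m] [IsRiemannianManifold (𝓡 m) M] [CompleteSpace M]
    (hcomp : IsCompact {x | halfSqDist φ c x ≤ a + 1}) : IsInteriorOfCompact m M := by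
  have hv := hφ.contMDiff_smul_gradField c (hφ.contMDiff_ascentFactor hT)
  have h := isCompleteField_of_bounded hv (hφ.norm_ascentFactor_smul_le hT)
  refine Sublevel.isInteriorOfCompact_of_flow (hφ.contMDiff_halfSqDist c) (contMDiff_flow hv h)
    (flow_zero h) (flow_flow hv h) (χ := fun r => Real.smoothTransition (r - (a - 1)))
    (fun x t => ?_) (fun r => Real.smoothTransition.nonneg _)
    (fun r => Real.smoothTransition.le_one _)
    (fun r hr => Real.smoothTransition.one_of_one_le (by linarith)) hcomp
  rw [← ascentFactor_mul_norm_sq hT]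
  exact hφ.hasDerivAt_halfSqDist (isMIntegralCurve_flow h x) t

end IsIsometricImmersion

end ImmersedSubmanifold

end

theorem theorem1 {m n : ℕ} [NeZero m] {M : Type*} [MetricSpace M] [CompleteSpace M]
    [ChartedSpace (EuclideanSpace ℝ (Fin m)) M] [IsManifold (𝓡 m) ∞ M]
    [Bundle.RiemannianBundle (fun x : M => TangentSpace (𝓡 m) x)]
    [IsContMDiffRiemannianBundle (𝓡 m) ∞ (EuclideanSpace ℝ (Fin m))
      (fun x : M => TangentSpace (𝓡 m) x)]
    [IsRiemannianManifold (𝓡 m) M]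
    (φ : M → EuclideanSpace ℝ (Fin n))
    (hφ : ImmersedSubmanifold.IsIsometricImmersion (m := m) φ)
    (p : M) (K : CompactExhaustion M)
    (ha : ImmersedSubmanifold.decayRate (m := m) φ p K < 1) :
    IsProperMap φ ∧ ImmersedSubmanifold.IsInteriorOfCompact m M := by
  obtain ⟨R, hfar, hgrowth⟩ := hφ.exists_growth_bound ha
  -- as `halfSqDist φ (φ p) ≤ ρ ^ 2 / 2`, the level `R ^ 2 / 2` is reached only where `R ≤ ρ`
  refine ⟨hφ.isProperMap hgrowth, hφ.isInteriorOfCompact (c := φ p) (a := R ^ 2 / 2 + 1)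
    (fun x hx => ?_) (hφ.isCompact_halfSqDist_le hgrowth _)⟩
  have h1 : ‖φ x - φ p‖ ≤ dist p x :=
    (hφ.norm_sub_le_dist x p).trans_eq (dist_comm x p)
  have h2 : R ^ 2 / 2 + 1 - 1 ≤ ‖φ x - φ p‖ ^ 2 / 2 := hx
  have h3 : ‖φ x - φ p‖ ^ 2 ≤ dist p x ^ 2 := by gcongr
  exact hfar x (le_of_abs_le (abs_le_of_sq_le_sq (by linarith) dist_nonneg))
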